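/- Let $L,T>0$ and let $\Omega=\mathbb{R}/L\mathbb{Z}$ be the periodic interval of length $L$. Consider on $\Omega\times(0,T)$ the thin-film Cahn--Hilliard system $$h_t=-J_x,\qquad (c\,h)_t=-(c\,J)_x+(h\,\mu_x)_x,$$ $$J=h^3h_{xxx}-\frac{h_x}{h}-h^2\left(h\,c_x^2\right)_x,\qquad \mu=c^3-c-\frac1h\left(h\,c_x\right)_x .$$ A solution on $[0,T]$ with initial data $(h_0,c_0)$ is a pair $(h,c)$ of real functions on $\Omega\times[0,T]$ with $h>0$, $h(\cdot,0)=h_0$, $c(\cdot,0)=c_0$, both functions belonging to $$L^\infty\left(0,T;W^{2,2}(\Omega)\right)\cap L^2\left(0,T;W^{4,2}(\Omega)\right)\cap C^{\frac32,\frac18}\left(\Omega\times[0,T]\right)$$ (the last class: $u_x$ exists and is Hölder continuous in $x$ with exponent $\frac12$ uniformly in $t$, and $u$ is Hölder continuous in $t$ with exponent $\frac18$ uniformly in $x$), and satisfying the equations in the weak sense, $$\int_0^T\!\!\int_\Omega \varphi_t\,h\,dx\,dt=-\int_0^T\!\!\int_\Omega\varphi_x\,J\,dx\,dt,\qquad \int_0^T\!\!\int_\Omega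 \psi_t\,c\,h\,dx\,dt=-\int_0^T\!\!\int_\Omega\psi_x\left(cJ-h\mu_x\right)dx\,dt$$ for all continuously differentiable test functions $\varphi,\psi$ that are $L$-periodic in $x$ and vanish at $t=0$ and $t=T$. (In particular, every strong solution in this class is a solution.) Solutions are unique: if $(h,c)$ and $(h',c')$ are two solutions on $[0,T]$ with the same initial data, then $h=h'$ and $c=c'$ everywhere on $\Omega\times[0,T]$. -/

import Mathlib

open MeasureTheory Set

noncomputable section

namespace ThinFilm

/-- `w` is the weak derivative of `v` on the circle `ℝ / L ℤ`: both are integrable over one period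
and `∫ v φ' = - ∫ w φ` for all smooth `L`-periodic test functions `φ`. -/
def HasPeriodicWeakDeriv (L : ℝ) (v w : ℝ → ℝ) : Prop :=
  IntervalIntegrable v volume 0 L ∧ IntervalIntegrable w volume 0 L ∧
    ∀ φ : ℝ → ℝ, ContDiff ℝ ((⊤ : ℕ∞) : WithTop ℕ∞) φ → Function.Periodic φ L →
      ∫ x in (0 : ℝ)..L, v x * deriv φ x = - ∫ x in (0 : ℝ)..L, w x * φ x

/-- `∑_{j ≤ k} ‖D j t‖²` with the norms of `L²(0, L)`; when `D j` is the `j`-th spatial weak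
derivative of `u`, this is the squared norm of `u(·, t)` in `W^{k,2}`. -/
def sobolevSq (L : ℝ) (k : ℕ) (D : ℕ → ℝ → ℝ → ℝ) (t : ℝ) : ENNReal :=
  ∑ j ∈ Finset.range (k + 1), ∫⁻ x in Ioo 0 L, ‖D j t x‖ₑ ^ 2

/-- `u t x`, for `t ∈ [0, T]`, is `L`-periodic in `x`, has the spatial weak derivatives
`D 0 = u, D 1, …, D 4`, and belongs to
`L^∞(0,T;W^{2,2}) ∩ L²(0,T;W^{4,2}) ∩ C^{3/2,1/8}([0,T] × ℝ/Lℤ)`.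
The last membership says that `∂ₓu` is Hölder continuous in space with exponent `1/2`, uniformly in
time, and that `u` is Hölder continuous in time with exponent `1/8`, uniformly in space. -/
structure InRegularityClass (L T : ℝ) (u : ℝ → ℝ → ℝ) (D : ℕ → ℝ → ℝ → ℝ) : Prop where
  periodic : ∀ t ∈ Icc 0 T, Function.Periodic (u t) L
  zero : D 0 = u
  aestronglyMeasurable : ∀ j ≤ 4, AEStronglyMeasurable (Function.uncurry (D j))
    ((volume.restrict (Ioo 0 T)).prod (volume.restrict (Ioo 0 L)))
  weakDeriv : ∀ j < 4, ∀ᵐ t ∂volume.restrict (Ioo 0 T),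
    HasPeriodicWeakDeriv L (D j t) (D (j + 1) t)
  linfty_W22 : essSup (sobolevSq L 2 D) (volume.restrict (Ioo 0 T)) < ⊤
  l2_W42 : ∫⁻ t in Ioo 0 T, sobolevSq L 4 D t < ⊤
  differentiable : ∀ t ∈ Icc 0 T, Differentiable ℝ (u t)
  holder_space : ∃ C : ℝ, ∀ t ∈ Icc 0 T, ∀ x y : ℝ,
    |deriv (u t) x - deriv (u t) y| ≤ C * |x - y| ^ (1 / 2 : ℝ)
  holder_time : ∃ C : ℝ, ∀ t ∈ Icc 0 T, ∀ s ∈ Icc 0 T, ∀ x : ℝ,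
    |u t x - u s x| ≤ C * |t - s| ^ (1 / 8 : ℝ)

/-- The flux `J = h³ h_xxx - h⁻¹ h_x - h² (h c_x²)_x` of the height equation, with
`(h c_x²)_x = h_x c_x² + 2 h c_x c_xx`, where `H j` and `C j` are the `j`-th spatial derivatives of
`h = H 0` and `c = C 0`. -/
def heightFlux (H C : ℕ → ℝ → ℝ → ℝ) (t x : ℝ) : ℝ :=
  H 0 t x ^ 3 * H 3 t x - H 1 t x / H 0 t x
    - H 0 t x ^ 2 * (H 1 t x * C 1 t x ^ 2 + 2 * H 0 t x * C 1 t x * C 2 t x)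

/-- `μ_x` for the chemical potential
`μ = c³ - c - h⁻¹ (h c_x)_x = c³ - c - h⁻¹ h_x c_x - c_xx`. -/
def chemPotentialDeriv (H C : ℕ → ℝ → ℝ → ℝ) (t x : ℝ) : ℝ :=
  (3 * C 0 t x ^ 2 - 1) * C 1 t x + H 1 t x ^ 2 * C 1 t x / H 0 t x ^ 2
    - H 2 t x * C 1 t x / H 0 t x - H 1 t x * C 2 t x / H 0 t x - C 3 t x

/-- The flux `K = c J - h μ_x` of the concentration equation. -/
def concFlux (H C : ℕ → ℝ → ℝ → ℝ) (t x : ℝ) : ℝ :=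
  C 0 t x * heightFlux H C t x - H 0 t x * chemPotentialDeriv H C t x

/-- Continuously differentiable test functions, `L`-periodic in space, vanishing at the times `0`
and `T`. -/
structure IsTestFunction (L T : ℝ) (φ : ℝ → ℝ → ℝ) : Prop where
  contDiff : ContDiff ℝ 1 (Function.uncurry φ)
  periodic : ∀ t, Function.Periodic (φ t) L
  initial : ∀ x, φ 0 x = 0
  final : ∀ x, φ T x = 0

/-- The conservation law `w_t = - F_x` on `(0, T) × ℝ/Lℤ` in the weak sense. -/
def WeakConservationLaw (L T : ℝ) (w F : ℝ → ℝ → ℝ) : Prop :=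
  ∀ φ : ℝ → ℝ → ℝ, IsTestFunction L T φ →
    ∫ t in (0 : ℝ)..T, ∫ x in (0 : ℝ)..L, deriv (fun s => φ s x) t * w t x =
      - ∫ t in (0 : ℝ)..T, ∫ x in (0 : ℝ)..L, deriv (φ t) x * F t x

/-- `(h, c)` is a solution on `[0, T]`, in the regularity class, of the thin-film Cahn--Hilliard
system `h_t = -J_x`, `(c h)_t = -(c J)_x + (h μ_x)_x` with initial data `(h₀, c₀)`, with `h > 0`.
The equations are imposed in the weak sense; in particular every strong solution in this regularity
class is covered. -/
def IsSolution (L T : ℝ) (h₀ c₀ : ℝ → ℝ) (h c : ℝ → ℝ → ℝ) : Prop :=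
  (∀ x, h 0 x = h₀ x) ∧ (∀ x, c 0 x = c₀ x) ∧
  (∀ t ∈ Icc 0 T, ∀ x, 0 < h t x) ∧
  ∃ H C : ℕ → ℝ → ℝ → ℝ,
    InRegularityClass L T h H ∧ InRegularityClass L T c C ∧
    WeakConservationLaw L T h (heightFlux H C) ∧
    WeakConservationLaw L T (fun t x => c t x * h t x) (concFlux H C)

end ThinFilm

end

/-! Write J, K for the fluxes of h and c h, and η = h - h', γ = c - c', ω = c h - c' h'. The
equations govern h and c h, so the energy is E = Λ ∫ η² + ∫ ω², and testing the differences of the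
equations with η and ω gives E' = 2 ∫ (Λ η_x (J - J') + ω_x (K - K')), in time-integrated form
(`energy_identity`).

To leading order J - J' is h³ η_xxx and K - K' is c h³ η_xxx + h γ_xxx, while ω_xx is h γ_xx + c
η_xx. Moving one derivative off the third-order terms leaves the quadratic form -Λ h³ η_xx² - (c h³
η_xx + h γ_xx)(h γ_xx + c η_xx). It already contains -h² γ_xx², h is bounded below, and so a large Λ
absorbs the cross terms and makes the form at most -κ (η_xx² + γ_xx²) (`leading_part_le`).

In the remainders, h, 1/h, c, h_x, c_x are bounded by a constant M, and the second and third
derivatives by some g(t) ≥ 1; by Sobolev embedding and the L²(0,T;W^{4,2}) bound, g² can be taken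
integrable in time. After Young's inequality the remainders are at most K g (η_x² + γ_x²) + K g² (η²
+ γ²) (`dissipation_le`). The powers of g matter: interpolating ∫ η_x² = -∫ η η_xx with weight g
costs g² ∫ η² and a little of the dissipation (`integral_powerDensity_le`). Since γ = (ω - c' η) /
h, the outcome is E' ≤ C g² E in integrated form, and Grönwall's inequality with an integrable
coefficient gives E = 0.

Two issues of regularity remain. Solutions have no given time derivative, so the energy identity is
derived from increments in time, using the joint continuity of the spatial derivative. The spatial
derivatives of order up to four are only weak; at almost every time `exists_profile` replaces those
of order up to three by the derivatives of a C³ function, after which all integrations by parts in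
space are classical. -/

open MeasureTheory Set Filter Topology

namespace ThinFilm

/-! ### Weak derivatives on the circle -/

/-- Integration by parts for the primitive of an integrable function. -/
lemma integral_primitive_mul_deriv {w φ : ℝ → ℝ} {a b : ℝ}
    (hw : IntervalIntegrable w volume a b) (hφ : ContDiff ℝ 1 φ) :
    ∫ x in a..b, (∫ y in a..x, w y) * deriv φ x =
      (∫ y in a..b, w y) * φ b - ∫ x in a..b, w x * φ x := by
  have h1 := hw.absolutelyContinuousOnInterval_intervalIntegral (c := a) left_mem_uIcc
  have h2 : AbsolutelyContinuousOnInterval φ a b :=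
    hφ.contDiffOn.absolutelyContinuousOnInterval
  rw [h1.integral_mul_deriv_eq_deriv_mul h2]
  simp only [intervalIntegral.integral_same, zero_mul, sub_zero]
  congr 1
  apply intervalIntegral.integral_congr_ae
  filter_upwards [hw.ae_hasDerivAt_integral] with x hx hx'
  rw [(hx (uIoc_subset_uIcc hx') a left_mem_uIcc).deriv]

/-- The `L`-periodic extension of the restriction of `g` to `[0, L)`. -/
noncomputable def periodize (L : ℝ) (g : ℝ → ℝ) (x : ℝ) : ℝ := g (L * Int.fract (x / L))

lemma periodize_periodic {L : ℝ} (hL : 0 < L) (g : ℝ → ℝ) :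
    Function.Periodic (periodize L g) L := by
  intro x
  simp [periodize, add_div, div_self hL.ne']

lemma periodize_eq {L : ℝ} (hL : 0 < L) (g : ℝ → ℝ) {x : ℝ} (hx : x ∈ Ico 0 L) :
    periodize L g x = g x := by
  have : Int.fract (x / L) = x / L :=
    Int.fract_eq_self.2 ⟨div_nonneg hx.1 hL.le, (div_lt_one hL).2 hx.2⟩
  rw [periodize, this, mul_div_cancel₀ _ hL.ne']

/-- Because g vanishes off some [a, b] inside (0, L), only one translate of g can be nonzero near a
given point x. With k the floor of x / L, the periodization therefore agrees near x with g(· - k L),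
also when x is a multiple of L. -/
lemma periodize_contDiff {L : ℝ} (hL : 0 < L) {g : ℝ → ℝ} {n : WithTop ℕ∞} (hg : ContDiff ℝ n g)
    (hc : HasCompactSupport g) (hs : tsupport g ⊆ Ioo 0 L) :
    ContDiff ℝ n (periodize L g) := by
  obtain ⟨a, b, ha, hb, hab⟩ : ∃ a b, 0 < a ∧ b < L ∧ ∀ x, x ∉ Icc a b → g x = 0 := by
    by_cases hne : (tsupport g).Nonempty
    · obtain ⟨p, hp, hp'⟩ := hc.exists_isLeast hne
      obtain ⟨q, hq, hq'⟩ := hc.exists_isGreatest hne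
      refine ⟨p, q, (hs hp).1, (hs hq).2, fun x hx => ?_⟩
      by_contra h0
      have := subset_tsupport g h0
      exact hx ⟨hp' this, hq' this⟩
    · refine ⟨L, 0, hL, hL, fun x _ => ?_⟩
      by_contra h0
      exact hne ⟨x, subset_tsupport g h0⟩
  rw [contDiff_iff_contDiffAt]
  intro x
  set k : ℤ := ⌊x / L⌋
  have hk1 : (k : ℝ) * L ≤ x := (le_div_iff₀ hL).1 (Int.floor_le _)
  have hk2 : x < (k + 1) * L := (div_lt_iff₀ hL).1 (Int.lt_floor_add_one _)
  have hcd : ContDiffAt ℝ n (fun y => g (y - k * L)) x :=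
    (hg.comp (contDiff_id.sub contDiff_const)).contDiffAt
  refine hcd.congr_of_eventuallyEq ?_
  filter_upwards [Ioo_mem_nhds (a := (k - 1) * L + b) (b := (k + 1) * L + a) (by nlinarith)
    (by nlinarith), Ioo_mem_nhds (a := (k - 1) * L) (b := (k + 2) * L) (by nlinarith)
    (by nlinarith)] with y hy hy2
  have per : periodize L g y = periodize L g (y - k * L) :=
    ((periodize_periodic hL g).sub_int_mul_eq k).symm
  rw [per]
  rcases lt_or_ge (y - k * L) 0 with h | h
  · rw [← periodize_periodic hL g, periodize_eq hL g ⟨by linarith [hy2.1], by linarith⟩,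
      hab, hab]
    · intro h'; linarith [h'.1]
    · intro h'; linarith [h'.2, hy.1]
  · rcases lt_or_ge (y - k * L) L with h3 | h3
    · exact periodize_eq hL g ⟨h, h3⟩
    · rw [← (periodize_periodic hL g).sub_eq, periodize_eq hL g ⟨by linarith,
        by linarith [hy2.2]⟩, hab, hab]
      · intro h'; linarith [h'.2]
      · intro h'; linarith [h'.1, hy.2]

/-- A weak derivative on the circle is an almost everywhere derivative: `v` is a primitive of `w`,
and `w` has mean zero. -/
lemma HasPeriodicWeakDeriv.exists_primitive {L : ℝ} (hL : 0 < L) {v w : ℝ → ℝ}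
    (h : HasPeriodicWeakDeriv L v w) :
    (∃ a, ∀ᵐ x ∂volume.restrict (Ioo 0 L), v x = a + ∫ y in (0 : ℝ)..x, w y) ∧
      ∫ y in (0 : ℝ)..L, w y = 0 := by
  obtain ⟨hv, hw, h⟩ := h
  have mean : ∫ y in (0 : ℝ)..L, w y = 0 := by
    have := h (fun _ => 1) contDiff_const (fun _ => rfl)
    simpa using this
  refine ⟨?_, mean⟩
  set W : ℝ → ℝ := fun x => ∫ y in (0 : ℝ)..x, w y with hW
  have hWc : ContinuousOn W (uIcc 0 L) :=
    intervalIntegral.continuousOn_primitive_interval'  hw left_mem_uIcc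
  have hWi : IntervalIntegrable W volume 0 L := hWc.intervalIntegrable
  set f : ℝ → ℝ := fun x => v x - W x with hf
  have hfi : IntervalIntegrable f volume 0 L := hv.sub hWi
  have key : ∀ φ : ℝ → ℝ, ContDiff ℝ ((⊤ : ℕ∞) : WithTop ℕ∞) φ → Function.Periodic φ L →
      ∫ x in (0 : ℝ)..L, f x * deriv φ x = 0 := by
    intro φ hφ hper
    have hφ1 : ContDiff ℝ 1 φ := hφ.of_le (by exact_mod_cast le_top)
    have hφc : ContinuousOn (deriv φ) (uIcc 0 L) := (hφ1.continuous_deriv le_rfl).continuousOn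
    simp only [hf, sub_mul]
    rw [intervalIntegral.integral_sub (hv.mul_continuousOn hφc) (hWi.mul_continuousOn hφc),
      h φ hφ hper, integral_primitive_mul_deriv hw hφ1, mean]
    ring
  -- It remains to see that f = v - W is constant, the constant being its mean m; this is tested
  -- against g supported in (0, L).
  set m : ℝ := (∫ x in (0 : ℝ)..L, f x) / L with hm
  have hz : ∀ᵐ x ∂volume, x ∈ Ioo 0 L → f x - m = 0 := by
    apply isOpen_Ioo.ae_eq_zero_of_integral_contDiff_smul_eq_zero
    · apply IntegrableOn.locallyIntegrableOn
      have : IntervalIntegrable (fun x => f x - m) volume 0 L :=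
        hfi.sub intervalIntegrable_const
      rw [intervalIntegrable_iff_integrableOn_Ioo_of_le hL.le] at this
      exact this
    · intro g hg hgc hgs
      set G := periodize L g with hG
      have hGs : ContDiff ℝ ((⊤ : ℕ∞) : WithTop ℕ∞) G := periodize_contDiff hL hg hgc hgs
      have hGc : Continuous G := hGs.continuous
      -- Subtracting the mean n makes the primitive φ of G - n periodic, hence an admissible test
      -- function. Then ∫ f (G - n) = 0, and n ∫ f = m ∫ G turns this into ∫ G (f - m) = 0.
      set n : ℝ := (∫ x in (0 : ℝ)..L, G x) / L with hn
      set φ : ℝ → ℝ := fun x => ∫ y in (0 : ℝ)..x, (G y - n) with hφ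
      have hcont : Continuous (fun y => G y - n) := hGc.sub continuous_const
      have hder : ∀ x, HasDerivAt φ (G x - n) x := fun x =>
        intervalIntegral.integral_hasDerivAt_right (hcont.intervalIntegrable _ _)
          (hcont.stronglyMeasurableAtFilter _ _) hcont.continuousAt
      have hder' : deriv φ = fun x => G x - n := funext fun x => (hder x).deriv
      have hsm : ContDiff ℝ ((⊤ : ℕ∞) : WithTop ℕ∞) φ := by
        rw [contDiff_infty_iff_deriv]
        refine ⟨fun x => (hder x).differentiableAt, ?_⟩
        rw [hder']
        exact hGs.sub contDiff_const
      have hIG : ∫ y in (0 : ℝ)..L, (G y - n) = 0 := by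
        rw [intervalIntegral.integral_sub (hGc.intervalIntegrable _ _) intervalIntegrable_const]
        simp only [intervalIntegral.integral_const, hn, smul_eq_mul]
        field_simp
        ring
      have hper : Function.Periodic φ L := by
        intro x
        have hp : Function.Periodic (fun y => G y - n) L := fun y => by
          simp only [hG, periodize_periodic hL g y]
        have := hp.intervalIntegral_add_eq 0 x
        rw [zero_add, hIG] at this
        have h2 := intervalIntegral.integral_add_adjacent_intervals
          (hcont.intervalIntegrable (μ := volume) 0 x) (hcont.intervalIntegrable x (x + L))
        simp only [hφ]
        rw [← h2, ← this, add_zero]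
      have h0 := key φ hsm hper
      rw [hder'] at h0
      have e1 : ∫ x, g x • (f x - m) = ∫ x in (0 : ℝ)..L, g x * (f x - m) := by
        rw [intervalIntegral.integral_of_le hL.le, integral_Ioc_eq_integral_Ioo,
          setIntegral_eq_integral_of_forall_compl_eq_zero]
        · rfl
        · intro x hx
          rw [image_eq_zero_of_notMem_tsupport (fun h' => hx (hgs h')), zero_mul]
      have e2 : ∫ x in (0 : ℝ)..L, g x * (f x - m) = ∫ x in (0 : ℝ)..L, G x * (f x - m) := by
        rw [intervalIntegral.integral_of_le hL.le, intervalIntegral.integral_of_le hL.le,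
          integral_Ioc_eq_integral_Ioo, integral_Ioc_eq_integral_Ioo]
        refine setIntegral_congr_fun measurableSet_Ioo fun x hx => ?_
        simp only [hG, periodize_eq hL g ⟨hx.1.le, hx.2⟩]
      rw [e1, e2]
      have hGf : IntervalIntegrable (fun x => f x * G x) volume 0 L :=
        hfi.mul_continuousOn hGc.continuousOn
      have e3 : ∫ x in (0 : ℝ)..L, G x * (f x - m) =
          (∫ x in (0 : ℝ)..L, f x * G x) - m * ∫ x in (0 : ℝ)..L, G x := by
        rw [← intervalIntegral.integral_const_mul, ← intervalIntegral.integral_sub hGf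
          ((hGc.intervalIntegrable _ _).const_mul _)]
        refine intervalIntegral.integral_congr fun x _ => ?_
        ring
      have e4 : ∫ x in (0 : ℝ)..L, f x * (G x - n) =
          (∫ x in (0 : ℝ)..L, f x * G x) - n * ∫ x in (0 : ℝ)..L, f x := by
        rw [← intervalIntegral.integral_const_mul, ← intervalIntegral.integral_sub hGf
          (hfi.const_mul _)]
        refine intervalIntegral.integral_congr fun x _ => ?_
        ring
      rw [e4] at h0
      rw [e3]
      refine Eq.trans ?_ h0
      congr 1
      rw [hm, hn, div_mul_eq_mul_div, div_mul_eq_mul_div, mul_comm]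
  refine ⟨m, ?_⟩
  rw [ae_restrict_iff' measurableSet_Ioo]
  filter_upwards [hz] with x hx hx'
  have := hx hx'
  simp only [hf] at this
  linarith

/-! ### Sobolev embedding and smooth representatives -/

/-- `v 0, …, v 3` are a `C³` function on the circle and its derivatives, restricted to one
period. -/
structure IsProfile (L : ℝ) (v : ℕ → ℝ → ℝ) : Prop where
  cont : ∀ j ≤ 3, ContinuousOn (v j) (Icc 0 L)
  hasDerivAt : ∀ j < 3, ∀ x ∈ Ioo 0 L, HasDerivAt (v j) (v (j + 1) x) x
  endpoint : ∀ j < 3, v j L = v j 0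

/-- Cauchy–Schwarz, read off from the nonnegativity of the variance of |f|: I / L is its mean. -/
lemma sq_integral_abs_le {L : ℝ} (hL : 0 < L) {f : ℝ → ℝ}
    (hf : IntervalIntegrable f volume 0 L) (hf2 : IntervalIntegrable (fun x => f x ^ 2) volume 0 L) :
    (∫ x in (0 : ℝ)..L, |f x|) ^ 2 ≤ L * ∫ x in (0 : ℝ)..L, f x ^ 2 := by
  set I := ∫ x in (0 : ℝ)..L, |f x| with hI
  have h0 : 0 ≤ ∫ x in (0 : ℝ)..L, (|f x| - I / L) ^ 2 :=
    intervalIntegral.integral_nonneg hL.le fun x _ => sq_nonneg _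
  have e : ∫ x in (0 : ℝ)..L, (|f x| - I / L) ^ 2 =
      (∫ x in (0 : ℝ)..L, f x ^ 2) - I ^ 2 / L := by
    have : ∀ x, (|f x| - I / L) ^ 2 = (f x ^ 2 - (2 * I / L) * |f x|) + (I / L) ^ 2 := fun x => by
      rw [sub_sq, sq_abs]; ring
    simp only [this]
    rw [intervalIntegral.integral_add (hf2.sub (hf.abs.const_mul _)) intervalIntegrable_const,
      intervalIntegral.integral_sub hf2 (hf.abs.const_mul _), intervalIntegral.integral_const_mul,
      ← hI, intervalIntegral.integral_const]
    simp only [smul_eq_mul, sub_zero]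
    field_simp
    ring
  rw [e, sub_nonneg, div_le_iff₀ hL] at h0
  linarith

/-- The one-dimensional Sobolev embedding `W^{1,2}(0, L) ⊆ L^∞`. -/
lemma sq_le_of_primitive {L : ℝ} (hL : 0 < L) {v w : ℝ → ℝ} {B : ℝ}
    (hv : ContinuousOn v (Icc 0 L)) (hw : IntervalIntegrable w volume 0 L)
    (hw2 : IntervalIntegrable (fun x => w x ^ 2) volume 0 L)
    (hvw : ∀ x ∈ Icc 0 L, v x = v 0 + ∫ y in (0 : ℝ)..x, w y)
    (hvB : ∫ x in (0 : ℝ)..L, v x ^ 2 ≤ B) (hwB : ∫ x in (0 : ℝ)..L, w x ^ 2 ≤ B)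
    {x : ℝ} (hx : x ∈ Icc 0 L) : v x ^ 2 ≤ (2 / L + 2 * L) * B := by
  have hv' : ContinuousOn v (uIcc 0 L) := by rwa [uIcc_of_le hL.le]
  have hsub : ∀ y ∈ Icc 0 L, IntervalIntegrable w volume 0 y := fun y hy =>
    hw.mono_set (by rw [uIcc_of_le hL.le, uIcc_of_le hy.1]; exact Icc_subset_Icc_right hy.2)
  -- The oscillation of v is at most ∫ |w|; averaging this inequality over y bounds |v x| by L¹
  -- norms.
  have hd : ∀ y ∈ Icc 0 L, |v x| - (∫ z in (0 : ℝ)..L, |w z|) ≤ |v y| := by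
    intro y hy
    have h1 : v x - v y = ∫ z in y..x, w z := by
      rw [hvw x hx, hvw y hy, ← intervalIntegral.integral_interval_sub_left (hsub x hx) (hsub y hy)]
      ring
    have h2 : |v x - v y| ≤ ∫ z in (0 : ℝ)..L, |w z| := by
      rw [h1]
      refine (intervalIntegral.norm_integral_le_integral_norm_uIoc (f := w)).trans ?_
      rw [intervalIntegral.integral_of_le hL.le]
      refine setIntegral_mono_set ?_ (Eventually.of_forall fun z => abs_nonneg _) ?_
      · exact ((intervalIntegrable_iff_integrableOn_Ioc_of_le hL.le).1 hw).norm
      · refine (LE.le.eventuallyLE ?_)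
        intro z hz
        rw [mem_uIoc] at hz
        rcases hz with hz | hz
        · exact ⟨hy.1.trans_lt hz.1, hz.2.trans hx.2⟩
        · exact ⟨hx.1.trans_lt hz.1, hz.2.trans hy.2⟩
    have := abs_sub_abs_le_abs_sub (v x) (v y)
    linarith
  have hm : L * (|v x| - ∫ z in (0 : ℝ)..L, |w z|) ≤ ∫ y in (0 : ℝ)..L, |v y| := by
    have := intervalIntegral.integral_mono_on hL.le
      (intervalIntegrable_const (c := |v x| - ∫ z in (0 : ℝ)..L, |w z|))
      (hv'.abs.intervalIntegrable (μ := volume)) hd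
    rwa [intervalIntegral.integral_const, sub_zero, smul_eq_mul] at this
  have s1 := sq_integral_abs_le hL hv'.intervalIntegrable (hv'.pow 2).intervalIntegrable
  have s2 := sq_integral_abs_le hL hw hw2
  set p := ∫ y in (0 : ℝ)..L, |v y|
  set q := ∫ y in (0 : ℝ)..L, |w y|
  have h3 : L * |v x| ≤ p + L * q := by linarith
  have h4 : (L * |v x|) ^ 2 ≤ (p + L * q) ^ 2 :=
    pow_le_pow_left₀ (by positivity) h3 2
  -- The constant comes from (p + L q)² ≤ 2 p² + 2 L² q² with p² and q² at most L B, divided by L².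
  have h5 : L ^ 2 * v x ^ 2 ≤ L ^ 2 * ((2 / L + 2 * L) * B) := by
    have e : L ^ 2 * ((2 / L + 2 * L) * B) = 2 * (L * B) + 2 * L ^ 2 * (L * B) := by
      field_simp
    have e2 : (L * |v x|) ^ 2 = L ^ 2 * v x ^ 2 := by rw [mul_pow, sq_abs]
    rw [e, ← e2]
    have a1 : p ^ 2 ≤ L * B := s1.trans (by gcongr)
    have a2 : q ^ 2 ≤ L * B := s2.trans (by gcongr)
    have a3 : L ^ 2 * q ^ 2 ≤ L ^ 2 * (L * B) := by gcongr
    nlinarith [sq_nonneg (p - L * q)]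
  exact le_of_mul_le_mul_left h5 (by positivity)

/-- On a period, the primitive of a mean-zero continuous function. -/
lemma hasDerivAt_primitive {L a : ℝ} {v w : ℝ → ℝ}
    (hw : ContinuousOn w (Icc 0 L)) (hv : ∀ x ∈ Icc 0 L, v x = a + ∫ y in (0 : ℝ)..x, w y)
    {x : ℝ} (hx : x ∈ Ioo 0 L) : HasDerivAt v (w x) x := by
  have hn : Icc 0 L ∈ 𝓝 x := Icc_mem_nhds hx.1 hx.2
  have hi : IntervalIntegrable w volume 0 x :=
    ContinuousOn.intervalIntegrable
      (hw.mono (by rw [uIcc_of_le hx.1.le]; exact Icc_subset_Icc_right hx.2.le))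
  have h := intervalIntegral.integral_hasDerivAt_right hi
    (ContinuousOn.stronglyMeasurableAtFilter_nhdsWithin hw measurableSet_Icc x |>.filter_mono
      (le_of_eq (nhdsWithin_eq_nhds.2 hn).symm)) (hw.continuousAt hn)
  refine (h.const_add a).congr_of_eventuallyEq ?_
  filter_upwards [hn] with y hy using hv y hy

lemma eqOn_Icc_of_ae {L : ℝ} {f g : ℝ → ℝ} (hL : 0 < L) (hf : ContinuousOn f (Icc 0 L))
    (hg : ContinuousOn g (Icc 0 L)) (h : ∀ᵐ x ∂volume.restrict (Ioo 0 L), f x = g x) :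
    EqOn f g (Icc 0 L) := by
  have h1 : EqOn f g (Ioo 0 L) :=
    Measure.eqOn_open_of_ae_eq h isOpen_Ioo (hf.mono Ioo_subset_Icc_self)
      (hg.mono Ioo_subset_Icc_self)
  have := h1.of_subset_closure hf hg Ioo_subset_Icc_self
  exact this (by rw [closure_Ioo hL.ne])

lemma integral_congr_ae_Ioo {L : ℝ} {f g : ℝ → ℝ}
    (h : ∀ᵐ x ∂volume.restrict (Ioo 0 L), f x = g x) {x : ℝ} (hx : x ∈ Icc 0 L) :
    ∫ y in (0 : ℝ)..x, f y = ∫ y in (0 : ℝ)..x, g y := by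
  rw [intervalIntegral.integral_of_le hx.1, intervalIntegral.integral_of_le hx.1,
    integral_Ioc_eq_integral_Ioo, integral_Ioc_eq_integral_Ioo]
  exact integral_congr_ae (ae_mono (Measure.restrict_mono (Ioo_subset_Ioo_right hx.2) le_rfl) h)

/-- A function in `W^{4,2}` of the circle is a `C³` function, with sup bounds for its second and
third derivatives. -/
lemma exists_profile {L : ℝ} (hL : 0 < L) {u : ℝ → ℝ} {D : ℕ → ℝ → ℝ} {B : ℝ}
    (hu : Differentiable ℝ u) (hu' : Continuous (deriv u)) (h0 : D 0 = u)
    (hD : ∀ j < 4, HasPeriodicWeakDeriv L (D j) (D (j + 1)))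
    (hD2 : ∀ j ≤ 4, IntervalIntegrable (fun x => D j x ^ 2) volume 0 L)
    (hB : ∀ j ≤ 4, ∫ x in (0 : ℝ)..L, D j x ^ 2 ≤ B) (hper : Function.Periodic u L) :
    ∃ v : ℕ → ℝ → ℝ, IsProfile L v ∧ v 0 = u ∧ v 1 = deriv u ∧
      (∀ j ≤ 3, ∀ᵐ x ∂volume.restrict (Ioo 0 L), D j x = v j x) ∧
      ∀ x ∈ Icc 0 L, v 2 x ^ 2 ≤ (2 / L + 2 * L) * B ∧ v 3 x ^ 2 ≤ (2 / L + 2 * L) * B := by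
  have hLL : L ∈ Icc 0 L := ⟨hL.le, le_rfl⟩
  have pc : ∀ (w : ℝ → ℝ) (a : ℝ), IntervalIntegrable w volume 0 L →
      ContinuousOn (fun x => a + ∫ y in (0 : ℝ)..x, w y) (Icc 0 L) := fun w a hw => by
    have := intervalIntegral.continuousOn_primitive_interval' hw left_mem_uIcc
    rw [uIcc_of_le hL.le] at this
    exact continuousOn_const.add this
  obtain ⟨⟨a0, e0⟩, -⟩ := (hD 0 (by norm_num)).exists_primitive hL
  obtain ⟨⟨a1, e1⟩, -⟩ := (hD 1 (by norm_num)).exists_primitive hL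
  obtain ⟨⟨a2, e2⟩, m2⟩ := (hD 2 (by norm_num)).exists_primitive hL
  obtain ⟨⟨a3, e3⟩, -⟩ := (hD 3 (by norm_num)).exists_primitive hL
  simp only [zero_add, Nat.reduceAdd] at e0 e1 e2 e3 m2
  have i1 := (hD 0 (by norm_num)).2.1
  have i2 := (hD 1 (by norm_num)).2.1
  have i3 := (hD 2 (by norm_num)).2.1
  have i4 := (hD 3 (by norm_num)).2.1
  simp only [zero_add, Nat.reduceAdd] at i1 i2 i3 i4
  set v3 : ℝ → ℝ := fun x => a3 + ∫ y in (0 : ℝ)..x, D 4 y with hv3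
  set v2 : ℝ → ℝ := fun x => a2 + ∫ y in (0 : ℝ)..x, D 3 y with hv2
  set v1 : ℝ → ℝ := fun x => a1 + ∫ y in (0 : ℝ)..x, D 2 y with hv1
  set v0 : ℝ → ℝ := fun x => a0 + ∫ y in (0 : ℝ)..x, D 1 y with hv0
  have c3 : ContinuousOn v3 (Icc 0 L) := pc _ _ i4
  have c2 : ContinuousOn v2 (Icc 0 L) := pc _ _ i3
  have c1 : ContinuousOn v1 (Icc 0 L) := pc _ _ i2
  have c0 : ContinuousOn v0 (Icc 0 L) := pc _ _ i1
  -- The primitive of `D 3` need not be differentiable everywhere as it stands; replacing `D 3`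
  -- almost everywhere by the continuous `v3` under the integral makes it so. The same is done at
  -- the lower orders.
  have d2 : ∀ x ∈ Ioo 0 L, HasDerivAt v2 (v3 x) x := fun x hx =>
    hasDerivAt_primitive (a := a2) c3
      (fun y hy => congrArg (a2 + ·) (integral_congr_ae_Ioo e3 hy)) hx
  have d1 : ∀ x ∈ Ioo 0 L, HasDerivAt v1 (v2 x) x := fun x hx =>
    hasDerivAt_primitive (a := a1) c2
      (fun y hy => congrArg (a1 + ·) (integral_congr_ae_Ioo e2 hy)) hx
  have d0 : ∀ x ∈ Ioo 0 L, HasDerivAt v0 (v1 x) x := fun x hx =>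
    hasDerivAt_primitive (a := a0) c1
      (fun y hy => congrArg (a0 + ·) (integral_congr_ae_Ioo e1 hy)) hx
  -- Both sides are continuous, so equality almost everywhere is equality, and the weak derivative
  -- of order one is identified with the classical one.
  have eq0 : EqOn u v0 (Icc 0 L) :=
    eqOn_Icc_of_ae hL hu.continuous.continuousOn c0 (by rwa [h0] at e0)
  have eq1' : EqOn (deriv u) v1 (Ioo 0 L) := fun x hx => by
    refine HasDerivAt.deriv ((d0 x hx).congr_of_eventuallyEq ?_)
    filter_upwards [Icc_mem_nhds hx.1 hx.2] with y hy using eq0 hy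
  have eq1 : EqOn (deriv u) v1 (Icc 0 L) :=
    (eq1'.of_subset_closure hu'.continuousOn c1 Ioo_subset_Icc_self)
      (by rw [closure_Ioo hL.ne])
  have dper : deriv u L = deriv u 0 := by
    have : (fun x => u (x + L)) = u := funext hper
    have h := deriv_comp_add_const u L 0
    rw [this, zero_add] at h
    exact h.symm
  have ae2 : ∀ᵐ x ∂volume.restrict (Ioo 0 L), D 1 x = deriv u x := by
    filter_upwards [e1, ae_restrict_mem measurableSet_Ioo] with x hx hx'
    rw [hx, eq1' hx']
  let v : ℕ → ℝ → ℝ := fun j => match j with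
    | 0 => u
    | 1 => deriv u
    | 2 => v2
    | _ => v3
  have sqb : ∀ j ≤ 4, ∀ w : ℝ → ℝ, (∀ᵐ x ∂volume.restrict (Ioo 0 L), D j x = w x) →
      ∫ x in (0 : ℝ)..L, w x ^ 2 ≤ B := fun j hj w hw => by
    rw [← integral_congr_ae_Ioo (f := fun x => D j x ^ 2) (by
      filter_upwards [hw] with x hx using by rw [hx]) hLL]
    exact hB j hj
  refine ⟨v, ⟨?_, ?_, ?_⟩, rfl, rfl, ?_, ?_⟩
  · intro j hj
    interval_cases j
    exacts [hu.continuous.continuousOn, hu'.continuousOn, c2, c3]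
  · intro j hj x hx
    interval_cases j
    · exact (hu x).hasDerivAt
    · refine (d1 x hx).congr_of_eventuallyEq ?_
      filter_upwards [Icc_mem_nhds hx.1 hx.2] with y hy using eq1 hy
    · exact d2 x hx
  -- Periodicity of the second derivative is the mean-zero property of `D 3`. Order three is not
  -- required, since the boundary terms below contain only derivatives of order at most two.
  · intro j hj
    interval_cases j
    · exact (congrArg u (zero_add L).symm).trans (hper 0)
    · exact dper
    · change a2 + _ = a2 + _
      rw [m2, intervalIntegral.integral_same]
  · intro j hj
    interval_cases j
    · exact Eventually.of_forall fun x => congrFun h0 x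
    exacts [ae2, e2, e3]
  · intro x hx
    refine ⟨sq_le_of_primitive hL c2 i3 (hD2 3 (by norm_num)) (fun y _ => ?_)
      (sqb 2 (by norm_num) _ e2) (hB 3 (by norm_num)) hx,
      sq_le_of_primitive hL c3 i4 (hD2 4 (by norm_num)) (fun y _ => ?_)
      (sqb 3 (by norm_num) _ e3) (hB 4 (by norm_num)) hx⟩
    · simp [hv2]
    · simp [hv3]

/-! ### Weak conservation laws and the energy identity -/

lemma eq_zero_of_integral_sq {L : ℝ} (hL : 0 < L) {f : ℝ → ℝ} (hf : ContinuousOn f (Icc 0 L))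
    (h : ∫ x in (0 : ℝ)..L, f x ^ 2 = 0) : ∀ x ∈ Icc 0 L, f x = 0 := by
  have hf' : ContinuousOn f (uIcc 0 L) := by rwa [uIcc_of_le hL.le]
  rw [intervalIntegral.integral_eq_zero_iff_of_le_of_nonneg_ae hL.le
    (Eventually.of_forall fun x => sq_nonneg (f x)) (hf'.pow 2).intervalIntegrable] at h
  refine eqOn_Icc_of_ae (g := fun _ => 0) hL hf continuousOn_const ?_
  have := ae_mono (Measure.restrict_mono Ioo_subset_Ioc_self le_rfl) h
  filter_upwards [this] with x hx
  exact pow_eq_zero_iff (two_ne_zero) |>.1 hx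

/-- If `m` is continuous and `G` is its weak derivative on `(0, T)`, then `m` is a primitive of
`G`. -/
lemma eq_primitive_of_weak_deriv {T : ℝ} (hT : 0 < T) {m G : ℝ → ℝ}
    (hm : ContinuousOn m (Icc 0 T)) (hG : IntervalIntegrable G volume 0 T)
    (h : ∀ θ : ℝ → ℝ, ContDiff ℝ 1 θ → θ 0 = 0 → θ T = 0 →
      ∫ t in (0 : ℝ)..T, deriv θ t * m t = - ∫ t in (0 : ℝ)..T, θ t * G t)
    {t : ℝ} (ht : t ∈ Icc 0 T) : m t - m 0 = ∫ s in (0 : ℝ)..t, G s := by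
  have hP := intervalIntegral.continuousOn_primitive_interval' hG left_mem_uIcc
  rw [uIcc_of_le hT.le] at hP
  -- du Bois-Reymond argument: n has zero weak derivative. It is extended by constants to all of ℝ
  -- so that the primitive θ of N - a is globally C¹; the mean a makes θ vanish at T. Testing with
  -- this θ gives ∫ (n - a)² = 0.
  set n : ℝ → ℝ := fun t => m t - ∫ s in (0 : ℝ)..t, G s with hn
  have hnc : ContinuousOn n (Icc 0 T) := hm.sub hP
  set N : ℝ → ℝ := IccExtend hT.le ((Icc 0 T).domRestrict n) with hN
  have hNc : Continuous N := (continuousOn_iff_continuous_domRestrict.1 hnc).Icc_extend'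
  have hNn : ∀ t ∈ Icc 0 T, N t = n t := fun t ht => IccExtend_of_mem _ _ ht
  set a : ℝ := (∫ t in (0 : ℝ)..T, N t) / T with ha
  have hc : Continuous fun t => N t - a := hNc.sub continuous_const
  set θ : ℝ → ℝ := fun t => ∫ s in (0 : ℝ)..t, (N s - a) with hθ
  have hd : ∀ t, HasDerivAt θ (N t - a) t := fun t =>
    intervalIntegral.integral_hasDerivAt_right (hc.intervalIntegrable _ _)
      (hc.stronglyMeasurableAtFilter _ _) hc.continuousAt
  have hd' : deriv θ = fun t => N t - a := funext fun t => (hd t).deriv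
  have hθ1 : ContDiff ℝ 1 θ := by
    rw [contDiff_one_iff_deriv]
    exact ⟨fun t => (hd t).differentiableAt, hd' ▸ hc⟩
  have hθT : θ T = 0 := by
    simp only [hθ]
    rw [intervalIntegral.integral_sub (hNc.intervalIntegrable _ _) intervalIntegrable_const,
      intervalIntegral.integral_const, ha]
    simp only [sub_zero, smul_eq_mul]
    field_simp
    ring
  have h1 := h θ hθ1 (by simp [hθ]) hθT
  have h2 := integral_primitive_mul_deriv hG hθ1
  rw [hθT, mul_zero, zero_sub] at h2
  have hm' : ContinuousOn m (uIcc 0 T) := by rwa [uIcc_of_le hT.le]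
  have hP' : ContinuousOn (fun t => ∫ s in (0 : ℝ)..t, G s) (uIcc 0 T) := by
    rwa [uIcc_of_le hT.le]
  have hdc : ContinuousOn (deriv θ) (uIcc 0 T) := by rw [hd']; exact hc.continuousOn
  have h3 : ∫ t in (0 : ℝ)..T, deriv θ t * n t = 0 := by
    have e : ∀ t, deriv θ t * n t =
        deriv θ t * m t - (∫ s in (0 : ℝ)..t, G s) * deriv θ t := fun t => by
      simp only [hn]; ring
    simp only [e]
    have i1 : IntervalIntegrable (fun t => deriv θ t * m t) volume 0 T :=
      (hdc.mul hm').intervalIntegrable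
    have i2 : IntervalIntegrable (fun t => (∫ s in (0 : ℝ)..t, G s) * deriv θ t) volume 0 T :=
      (hP'.mul hdc).intervalIntegrable
    rw [intervalIntegral.integral_sub i1 i2, h1, h2]
    simp only [mul_comm, sub_self]
  have h4 : ∫ t in (0 : ℝ)..T, (n t - a) ^ 2 = 0 := by
    have e : ∫ t in (0 : ℝ)..T, (n t - a) ^ 2 =
        ∫ t in (0 : ℝ)..T, (deriv θ t * n t - a * deriv θ t) := by
      refine intervalIntegral.integral_congr fun t ht => ?_
      rw [uIcc_of_le hT.le] at ht
      simp only [hd', hNn t ht]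
      ring
    have hn' : ContinuousOn n (uIcc 0 T) := by rwa [uIcc_of_le hT.le]
    have i1 : IntervalIntegrable (fun t => deriv θ t * n t) volume 0 T :=
      (hdc.mul hn').intervalIntegrable
    rw [e, intervalIntegral.integral_sub i1
      (hdc.intervalIntegrable.const_mul _), h3, intervalIntegral.integral_const_mul]
    have : ∫ t in (0 : ℝ)..T, deriv θ t = 0 := by
      rw [hd']; exact hθT
    rw [this]; ring
  have h5 := eq_zero_of_integral_sq (f := fun t => n t - a) hT (hnc.sub continuousOn_const) h4
  have e1 := h5 t ht
  have e2 := h5 0 ⟨le_rfl, hT.le⟩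
  simp only [hn, intervalIntegral.integral_same] at e1 e2
  linarith

/-- Functions on `[0, T]` times the circle that are continuous together with their spatial
derivative. -/
structure IsC1Periodic (L T : ℝ) (u : ℝ → ℝ → ℝ) : Prop where
  periodic : ∀ t ∈ Icc 0 T, Function.Periodic (u t) L
  differentiable : ∀ t ∈ Icc 0 T, Differentiable ℝ (u t)
  continuousOn : ContinuousOn (Function.uncurry u) (Icc 0 T ×ˢ univ)
  continuousOn_deriv : ContinuousOn (fun p : ℝ × ℝ => deriv (u p.1) p.2) (Icc 0 T ×ˢ univ)

section

variable {L T : ℝ} {F g u v : ℝ → ℝ → ℝ}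

lemma continuous_slice (hg : ContinuousOn (Function.uncurry g) (Icc 0 T ×ˢ univ)) {t : ℝ}
    (ht : t ∈ Icc 0 T) : Continuous (g t) := by
  rw [← continuousOn_univ]
  exact hg.comp (f := fun x => (t, x)) (by fun_prop) fun x _ => ⟨ht, mem_univ _⟩

lemma IsC1Periodic.continuous_deriv (hu : IsC1Periodic L T u) {t : ℝ} (ht : t ∈ Icc 0 T) :
    Continuous (deriv (u t)) :=
  continuous_slice (g := fun t => deriv (u t)) hu.continuousOn_deriv ht

lemma IsC1Periodic.contDiff (hu : IsC1Periodic L T u) {t : ℝ} (ht : t ∈ Icc 0 T) :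
    ContDiff ℝ 1 (u t) :=
  contDiff_one_iff_deriv.2 ⟨hu.differentiable t ht, hu.continuous_deriv ht⟩

lemma IsC1Periodic.sub (hu : IsC1Periodic L T u) (hv : IsC1Periodic L T v) :
    IsC1Periodic L T (fun t x => u t x - v t x) := by
  refine ⟨fun t ht x => ?_, fun t ht => (hu.differentiable t ht).sub (hv.differentiable t ht),
    hu.continuousOn.sub hv.continuousOn,
    (hu.continuousOn_deriv.sub hv.continuousOn_deriv).congr fun p hp => ?_⟩
  · simp only [hu.periodic t ht x, hv.periodic t ht x]
  · exact deriv_sub (hu.differentiable _ hp.1 _) (hv.differentiable _ hp.1 _)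

lemma IsC1Periodic.mul (hu : IsC1Periodic L T u) (hv : IsC1Periodic L T v) :
    IsC1Periodic L T (fun t x => u t x * v t x) := by
  refine ⟨fun t ht x => ?_, fun t ht => (hu.differentiable t ht).mul (hv.differentiable t ht),
    hu.continuousOn.mul hv.continuousOn,
    ((hu.continuousOn_deriv.mul hv.continuousOn).add
      (hu.continuousOn.mul hv.continuousOn_deriv)).congr fun p hp => ?_⟩
  · simp only [hu.periodic t ht x, hv.periodic t ht x]
  · exact deriv_mul (hu.differentiable _ hp.1 _) (hv.differentiable _ hp.1 _)

lemma intervalIntegral_eq_Ioo {a : ℝ} (ha : 0 ≤ a) (f : ℝ → ℝ) :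
    ∫ x in (0 : ℝ)..a, f x = ∫ x in Ioo 0 a, f x := by
  rw [intervalIntegral.integral_of_le ha, integral_Ioc_eq_integral_Ioo]

lemma intervalIntegrable_iff_Ioo {a : ℝ} (ha : 0 ≤ a) {f : ℝ → ℝ} :
    IntervalIntegrable f volume 0 a ↔ Integrable f (volume.restrict (Ioo 0 a)) :=
  intervalIntegrable_iff_integrableOn_Ioo_of_le ha

lemma integrable_continuousOn_mul (hg : ContinuousOn (Function.uncurry g) (Icc 0 T ×ˢ univ))
    (hF : Integrable (Function.uncurry F)
      ((volume.restrict (Ioo 0 T)).prod (volume.restrict (Ioo 0 L)))) :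
    Integrable (Function.uncurry fun t x => g t x * F t x)
      ((volume.restrict (Ioo 0 T)).prod (volume.restrict (Ioo 0 L))) := by
  have hg' : ContinuousOn (Function.uncurry g) (Icc 0 T ×ˢ Icc 0 L) :=
    hg.mono (prod_mono_right (subset_univ _))
  obtain ⟨C, hC⟩ := (isCompact_Icc.prod isCompact_Icc).exists_bound_of_continuousOn hg'
  rw [Measure.prod_restrict] at hF ⊢
  have hsub : Ioo 0 T ×ˢ Ioo 0 L ⊆ Icc 0 T ×ˢ Icc 0 L :=
    prod_mono Ioo_subset_Icc_self Ioo_subset_Icc_self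
  have hms : MeasurableSet (Ioo 0 T ×ˢ Ioo 0 L) := measurableSet_Ioo.prod measurableSet_Ioo
  refine hF.bdd_mul ((hg'.mono hsub).aestronglyMeasurable hms) (c := C) ?_
  filter_upwards [ae_restrict_mem hms] with p hp using hC p (hsub hp)

lemma ae_intervalIntegrable_slice (hL : 0 ≤ L) (hF : Integrable (Function.uncurry F)
      ((volume.restrict (Ioo 0 T)).prod (volume.restrict (Ioo 0 L)))) :
    ∀ᵐ t ∂volume.restrict (Ioo 0 T), IntervalIntegrable (F t) volume 0 L := by
  filter_upwards [hF.prod_right_ae] with t ht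
  exact (intervalIntegrable_iff_Ioo hL).2 ht

lemma intervalIntegrable_integral_slice (hL : 0 ≤ L) (hT : 0 ≤ T)
    (hF : Integrable (Function.uncurry F)
      ((volume.restrict (Ioo 0 T)).prod (volume.restrict (Ioo 0 L)))) :
    IntervalIntegrable (fun t => ∫ x in (0 : ℝ)..L, F t x) volume 0 T := by
  rw [intervalIntegrable_iff_Ioo hT]
  simp only [intervalIntegral_eq_Ioo hL]
  exact hF.integral_prod_left

lemma continuousOn_integral_slice (hT : 0 ≤ T)
    (hg : ContinuousOn (Function.uncurry g) (Icc 0 T ×ˢ univ)) :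
    ContinuousOn (fun t => ∫ x in (0 : ℝ)..L, g t x) (Icc 0 T) := by
  -- Projecting the time onto [0, T] makes the integrand continuous on the whole plane without
  -- changing it on the domain.
  have hc : Continuous (Function.uncurry fun t x => g (projIcc 0 T hT t) x) := by
    rw [← continuousOn_univ]
    refine hg.comp (f := fun p : ℝ × ℝ => ((projIcc 0 T hT p.1 : ℝ), p.2)) ?_ ?_
    · exact Continuous.continuousOn (by fun_prop)
    · exact fun p _ => ⟨(projIcc 0 T hT p.1).2, mem_univ _⟩
  refine (intervalIntegral.continuous_parametric_intervalIntegral_of_continuous' (μ := volume) hc 0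
    L).continuousOn.congr fun t ht => ?_
  simp only [projIcc_of_mem hT ht]

/-- The conservation law in time-integrated form. -/
lemma WeakConservationLaw.integral_sub_eq (hL : 0 < L) (hT : 0 < T)
    (h : WeakConservationLaw L T u F)
    (hu : ContinuousOn (Function.uncurry u) (Icc 0 T ×ˢ univ))
    (hF : Integrable (Function.uncurry F)
      ((volume.restrict (Ioo 0 T)).prod (volume.restrict (Ioo 0 L))))
    {ψ : ℝ → ℝ} (hψ : ContDiff ℝ 1 ψ) (hper : Function.Periodic ψ L) {t : ℝ} (ht : t ∈ Icc 0 T) :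
    (∫ x in (0 : ℝ)..L, ψ x * u t x) - (∫ x in (0 : ℝ)..L, ψ x * u 0 x) =
      ∫ s in (0 : ℝ)..t, ∫ x in (0 : ℝ)..L, deriv ψ x * F s x := by
  have hψ' := hψ.continuous_deriv le_rfl
  refine eq_primitive_of_weak_deriv hT (m := fun t => ∫ x in (0 : ℝ)..L, ψ x * u t x)
    (G := fun s => ∫ x in (0 : ℝ)..L, deriv ψ x * F s x) ?_ ?_ ?_ ht
  · refine continuousOn_integral_slice hT.le (g := fun t x => ψ x * u t x) ?_
    exact (hψ.continuous.comp continuous_snd).continuousOn.mul hu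
  · refine intervalIntegrable_integral_slice hL.le hT.le (F := fun s x => deriv ψ x * F s x) ?_
    exact integrable_continuousOn_mul (g := fun _ x => deriv ψ x)
      (hψ'.comp continuous_snd).continuousOn hF
  · intro θ hθ h0 h1
    -- Separated test functions suffice: they turn the conservation law into a weak ordinary
    -- differential equation in t for ∫ ψ u.
    have hφ : IsTestFunction L T fun t x => θ t * ψ x :=
      ⟨(hθ.comp contDiff_fst).mul (hψ.comp contDiff_snd), fun t x => by simp only [hper x],
        fun x => by simp only [h0, zero_mul], fun x => by simp only [h1, zero_mul]⟩
    have := h _ hφ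
    have d1 : ∀ t x, deriv (fun s => θ s * ψ x) t = deriv θ t * ψ x := fun t x =>
      deriv_mul_const (hθ.differentiable one_ne_zero t) _
    have d2 : ∀ t x, deriv (fun x => θ t * ψ x) x = θ t * deriv ψ x := fun t x =>
      deriv_const_mul _ (hψ.differentiable one_ne_zero x)
    simp only [d1, d2, mul_assoc, intervalIntegral.integral_const_mul] at this
    exact this

/-- If the increments of `Φ` over short intervals are dominated by those of `A`, then so are all
increments. -/
lemma abs_sub_le_of_short_increments {Φ A : ℝ → ℝ} {δ : ℝ} (hδ : 0 < δ)
    (h : ∀ s ∈ Icc 0 T, ∀ t ∈ Icc 0 T, s ≤ t → t - s ≤ δ → |Φ t - Φ s| ≤ A t - A s)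
    {t : ℝ} (ht : t ∈ Icc 0 T) : |Φ t - Φ 0| ≤ A t - A 0 := by
  have key : ∀ n : ℕ, ∀ t ∈ Icc 0 T, t ≤ n * δ → |Φ t - Φ 0| ≤ A t - A 0 := by
    intro n
    induction n with
    | zero =>
      intro t ht h'
      have : t = 0 := le_antisymm (by simpa using h') ht.1
      simp [this]
    | succ n ih =>
      intro t ht h'
      push_cast at h'
      have hs : max 0 (t - δ) ∈ Icc 0 T :=
        ⟨le_max_left _ _, max_le (ht.1.trans ht.2) (by linarith [ht.2])⟩
      have h1 := ih _ hs (max_le (by positivity) (by linarith))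
      have h2 := h _ hs t ht (max_le ht.1 (by linarith)) (by
        have := le_max_right 0 (t - δ); linarith)
      have := abs_sub_le (Φ t) (Φ (max 0 (t - δ))) (Φ 0)
      linarith
  obtain ⟨n, hn⟩ := exists_nat_ge (t / δ)
  exact key n t ht ((div_le_iff₀ hδ).1 hn)

/-- The energy identity for `u_t = - F_x`, where the equation is given in time-integrated form. -/
lemma energy_identity (hL : 0 < L) (hT : 0 < T) (hu : IsC1Periodic L T u)
    (hF : Integrable (Function.uncurry F)
      ((volume.restrict (Ioo 0 T)).prod (volume.restrict (Ioo 0 L))))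
    (h : ∀ ψ : ℝ → ℝ, ContDiff ℝ 1 ψ → Function.Periodic ψ L → ∀ t ∈ Icc 0 T,
      (∫ x in (0 : ℝ)..L, ψ x * u t x) - (∫ x in (0 : ℝ)..L, ψ x * u 0 x) =
        ∫ s in (0 : ℝ)..t, ∫ x in (0 : ℝ)..L, deriv ψ x * F s x)
    {t : ℝ} (ht : t ∈ Icc 0 T) :
    (∫ x in (0 : ℝ)..L, u t x ^ 2) - (∫ x in (0 : ℝ)..L, u 0 x ^ 2) =
      2 * ∫ s in (0 : ℝ)..t, ∫ x in (0 : ℝ)..L, deriv (u s) x * F s x := by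
  have hdF := integrable_continuousOn_mul (L := L) (g := fun t => deriv (u t))
    hu.continuousOn_deriv hF
  have hq := intervalIntegrable_integral_slice hL.le hT.le hdF
  have hN := intervalIntegrable_integral_slice (F := fun t x => |F t x|) hL.le hT.le hF.abs
  have hsl := ae_intervalIntegrable_slice hL.le hF
  have hdsl := ae_intervalIntegrable_slice hL.le hdF
  set q : ℝ → ℝ := fun s => ∫ x in (0 : ℝ)..L, deriv (u s) x * F s x with hqdef
  set N : ℝ → ℝ := fun s => ∫ x in (0 : ℝ)..L, |F s x| with hNdef
  have sub : ∀ {G : ℝ → ℝ}, IntervalIntegrable G volume 0 T → ∀ s ∈ Icc 0 T, ∀ t ∈ Icc 0 T,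
      IntervalIntegrable G volume s t := fun hG s hs t ht => hG.mono_set (by
    rw [uIcc_of_le hT.le]; exact uIcc_subset_Icc hs ht)
  have hT0 : (0 : ℝ) ∈ Icc 0 T := ⟨le_rfl, hT.le⟩
  have huc : ContinuousOn (fun p : ℝ × ℝ => deriv (u p.1) p.2) (Icc 0 T ×ˢ Icc 0 L) :=
    hu.continuousOn_deriv.mono (prod_mono_right (subset_univ _))
  have hunif := (isCompact_Icc.prod isCompact_Icc).uniformContinuousOn_of_continuous huc
  rw [Metric.uniformContinuousOn_iff] at hunif
  have cu : ∀ t ∈ Icc 0 T, Continuous (u t) := fun t ht => continuous_slice hu.continuousOn ht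
  -- The function t ↦ ∫ u(t)² - 2 ∫₀ᵗ q should be constant. Its increments over short time intervals
  -- are at most 2 ε times those of ∫₀ᵗ N; these bounds add up, and ε tends to zero at the end.
  have main : ∀ ε > 0, |((∫ x in (0 : ℝ)..L, u t x ^ 2) - 2 * ∫ s in (0 : ℝ)..t, q s) -
      ((∫ x in (0 : ℝ)..L, u 0 x ^ 2) - 2 * ∫ s in (0 : ℝ)..(0 : ℝ), q s)| ≤
        2 * ε * (∫ s in (0 : ℝ)..t, N s) - 2 * ε * (∫ s in (0 : ℝ)..(0 : ℝ), N s) := by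
    intro ε hε
    obtain ⟨δ, hδ, hδu⟩ := hunif ε hε
    refine abs_sub_le_of_short_increments
      (Φ := fun t => (∫ x in (0 : ℝ)..L, u t x ^ 2) - 2 * ∫ s in (0 : ℝ)..t, q s)
      (A := fun t => 2 * ε * (∫ s in (0 : ℝ)..t, N s)) (half_pos hδ) ?_ ht
    intro s hs t ht hst hd
    -- Testing the increment with u(t) + u(s) produces u(t)² - u(s)² exactly, so no time derivative
    -- of u is needed. For τ between s and t, its spatial derivative is within 2 ε of 2 u_x(τ) by
    -- uniform continuity.
    have hψ : ContDiff ℝ 1 (fun x => u t x + u s x) := (hu.contDiff ht).add (hu.contDiff hs)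
    have hψp : Function.Periodic (fun x => u t x + u s x) L := fun x => by
      simp only [hu.periodic t ht x, hu.periodic s hs x]
    have hψd : ∀ x, deriv (fun x => u t x + u s x) x = deriv (u t) x + deriv (u s) x := fun x =>
      deriv_add (hu.differentiable t ht x) (hu.differentiable s hs x)
    have hψc := hψ.continuous_deriv le_rfl
    have hG := intervalIntegrable_integral_slice hL.le hT.le
      (integrable_continuousOn_mul (L := L) (T := T)
        (g := fun _ => deriv (fun x => u t x + u s x)) (hψc.comp continuous_snd).continuousOn hF)
    have e1 := h _ hψ hψp t ht
    have e2 := h _ hψ hψp s hs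
    have e3 : (∫ x in (0 : ℝ)..L, u t x ^ 2) - (∫ x in (0 : ℝ)..L, u s x ^ 2) =
        ∫ τ in s..t, ∫ x in (0 : ℝ)..L, deriv (fun x => u t x + u s x) x * F τ x := by
      rw [← intervalIntegral.integral_interval_sub_left (sub hG 0 hT0 t ht) (sub hG 0 hT0 s hs),
        ← e1, ← e2]
      have ct := cu t ht
      have cs := cu s hs
      rw [sub_sub_sub_cancel_right,
        ← intervalIntegral.integral_sub (Continuous.intervalIntegrable (by fun_prop) _ _)
          (Continuous.intervalIntegrable (by fun_prop) _ _),
        ← intervalIntegral.integral_sub (Continuous.intervalIntegrable (by fun_prop) _ _)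
          (Continuous.intervalIntegrable (by fun_prop) _ _)]
      refine intervalIntegral.integral_congr fun x _ => ?_
      ring
    have e4 : ((∫ x in (0 : ℝ)..L, u t x ^ 2) - 2 * ∫ s in (0 : ℝ)..t, q s) -
        ((∫ x in (0 : ℝ)..L, u s x ^ 2) - 2 * ∫ s in (0 : ℝ)..s, q s) =
        ∫ τ in s..t, ((∫ x in (0 : ℝ)..L, deriv (fun x => u t x + u s x) x * F τ x) -
          2 * q τ) := by
      rw [intervalIntegral.integral_sub (sub hG s hs t ht) ((sub hq s hs t ht).const_mul 2),
        intervalIntegral.integral_const_mul, ← e3,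
        ← intervalIntegral.integral_interval_sub_left (sub hq 0 hT0 t ht) (sub hq 0 hT0 s hs)]
      ring
    rw [e4, ← mul_sub, intervalIntegral.integral_interval_sub_left (sub hN 0 hT0 t ht)
      (sub hN 0 hT0 s hs), ← intervalIntegral.integral_const_mul, ← Real.norm_eq_abs]
    refine intervalIntegral.norm_integral_le_of_norm_le hst ?_ ((sub hN s hs t ht).const_mul _)
    rw [ae_restrict_iff' measurableSet_Ioo] at hsl hdsl
    -- The half-open interval (s, t] may contain T, whereas the slice statements hold on the open
    -- interval.
    have hne : ∀ᵐ τ : ℝ, τ ≠ T := by simp [ae_iff]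
    filter_upwards [hsl, hdsl, hne] with τ h1 h2 h3 hτ
    have hτ' : τ ∈ Ioo 0 T := ⟨hs.1.trans_lt hτ.1, lt_of_le_of_ne (hτ.2.trans ht.2) h3⟩
    have hτ2 := Ioo_subset_Icc_self hτ'
    have i1 := h1 hτ'
    have i2 := h2 hτ'
    simp only [hqdef, hNdef]
    rw [← intervalIntegral.integral_const_mul, ← intervalIntegral.integral_sub
      (i1.continuousOn_mul hψc.continuousOn) (i2.const_mul 2),
      ← intervalIntegral.integral_const_mul]
    refine intervalIntegral.norm_integral_le_of_norm_le hL.le ?_ (i1.abs.const_mul _)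
    refine Eventually.of_forall fun x hx => ?_
    have hx' : x ∈ Icc 0 L := ⟨hx.1.le, hx.2⟩
    have b : ∀ r ∈ Icc 0 T, |r - τ| ≤ δ / 2 → |deriv (u r) x - deriv (u τ) x| ≤ ε := by
      intro r hr hd
      have := hδu (r, x) ⟨hr, hx'⟩ (τ, x) ⟨hτ2, hx'⟩ (by
        rw [Prod.dist_eq, dist_self, max_eq_left dist_nonneg, Real.dist_eq]
        linarith)
      rw [Real.dist_eq] at this
      exact this.le
    have b1 := b t ht (by rw [abs_of_nonneg (by linarith [hτ.2])]; linarith [hτ.1])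
    have b2 := b s hs (by rw [abs_of_nonpos (by linarith [hτ.1])]; linarith [hτ.2])
    rw [hψd, Real.norm_eq_abs]
    have e5 : (deriv (u t) x + deriv (u s) x) * F τ x - 2 * (deriv (u τ) x * F τ x) =
        ((deriv (u t) x - deriv (u τ) x) + (deriv (u s) x - deriv (u τ) x)) * F τ x := by ring
    rw [e5, abs_mul]
    gcongr
    refine (abs_add_le _ _).trans ?_
    linarith
  simp only [intervalIntegral.integral_same, mul_zero, sub_zero] at main
  have hz : |((∫ x in (0 : ℝ)..L, u t x ^ 2) - 2 * ∫ s in (0 : ℝ)..t, q s) -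
      (∫ x in (0 : ℝ)..L, u 0 x ^ 2)| ≤ 0 := by
    have lim : Tendsto (fun ε : ℝ => 2 * ε * (∫ s in (0 : ℝ)..t, N s)) (𝓝[>] 0) (𝓝 0) := by
      have : Continuous fun ε : ℝ => 2 * ε * (∫ s in (0 : ℝ)..t, N s) := by fun_prop
      have := (this.tendsto 0).mono_left (nhdsWithin_le_nhds (s := Ioi 0))
      simpa using this
    refine ge_of_tendsto lim ?_
    filter_upwards [self_mem_nhdsWithin] with ε hε using main ε hε
  have := abs_eq_zero.1 (le_antisymm hz (abs_nonneg _))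
  linarith

end

/-! ### Joint continuity and uniform bounds in the regularity class -/

section

variable {L T : ℝ} {u : ℝ → ℝ → ℝ} {D : ℕ → ℝ → ℝ → ℝ}

/-- The Hölder bound in time is uniform in x, so continuity in x is needed only at the fixed time s.
-/
lemma InRegularityClass.continuousOn (h : InRegularityClass L T u D) :
    ContinuousOn (Function.uncurry u) (Icc 0 T ×ˢ univ) := by
  obtain ⟨C, hC⟩ := h.holder_time
  rintro ⟨s, y⟩ ⟨hs, -⟩
  have hcont : Continuous fun p : ℝ × ℝ =>
      C * |p.1 - s| ^ (1 / 8 : ℝ) + |u s p.2 - u s y| := by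
    have := (h.differentiable s hs).continuous
    have h8 : Continuous fun r : ℝ => r ^ (1 / 8 : ℝ) :=
      Real.continuous_rpow_const (by norm_num)
    fun_prop
  have h0 : Tendsto (fun p : ℝ × ℝ => C * |p.1 - s| ^ (1 / 8 : ℝ) + |u s p.2 - u s y|)
      (𝓝[Icc 0 T ×ˢ univ] (s, y)) (𝓝 0) := by
    have := (hcont.tendsto (s, y)).mono_left (nhdsWithin_le_nhds (s := Icc 0 T ×ˢ univ))
    simpa using this
  rw [ContinuousWithinAt, tendsto_iff_dist_tendsto_zero]
  refine squeeze_zero' (Eventually.of_forall fun p => dist_nonneg) ?_ h0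
  filter_upwards [self_mem_nhdsWithin] with p hp
  rw [Real.dist_eq]
  have := hC p.1 hp.1 s hs p.2
  have h2 := abs_sub_le (u p.1 p.2) (u s p.2) (u s y)
  simp only [Function.uncurry]
  linarith

/-- Nothing is assumed on the time dependence of u_x. However, the forward difference quotients of
step 1 / (n + 1) are jointly continuous, and by the mean value theorem and the spatial Hölder bound
they differ from u_x by at most |C| (n + 1)^(-1/2). So u_x is their uniform limit. -/
lemma InRegularityClass.continuousOn_deriv (h : InRegularityClass L T u D) :
    ContinuousOn (fun p : ℝ × ℝ => deriv (u p.1) p.2) (Icc 0 T ×ˢ univ) := by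
  obtain ⟨C, hC⟩ := h.holder_space
  have hu := h.continuousOn
  let δ : ℕ → ℝ := fun n => 1 / ((n : ℝ) + 1)
  have hδ : ∀ n, 0 < δ n := fun n => Nat.one_div_pos_of_nat
  have hδ0 : Tendsto δ atTop (𝓝 0) := tendsto_one_div_add_atTop_nhds_zero_nat
  have hlim : Tendsto (fun n => |C| * δ n ^ (1 / 2 : ℝ)) atTop (𝓝 0) := by
    have h2 : Continuous fun r : ℝ => |C| * r ^ (1 / 2 : ℝ) :=
      continuous_const.mul (Real.continuous_rpow_const (by norm_num))
    have := (h2.tendsto 0).comp hδ0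
    simpa [Function.comp_def, Real.zero_rpow] using this
  have hunif : TendstoUniformlyOn
      (fun (n : ℕ) (p : ℝ × ℝ) => (u p.1 (p.2 + δ n) - u p.1 p.2) / δ n)
      (fun p : ℝ × ℝ => deriv (u p.1) p.2) atTop (Icc 0 T ×ˢ univ) := by
    rw [Metric.tendstoUniformlyOn_iff]
    intro ε hε
    filter_upwards [hlim.eventually_lt_const hε] with n hn p hp
    refine lt_of_le_of_lt ?_ hn
    obtain ⟨ξ, hξ, e⟩ := exists_deriv_eq_slope (u p.1) (lt_add_of_pos_right p.2 (hδ n))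
      (h.differentiable _ hp.1).continuous.continuousOn
      (h.differentiable _ hp.1).differentiableOn
    rw [add_sub_cancel_left] at e
    rw [← e, Real.dist_eq]
    refine (hC p.1 hp.1 _ _).trans ?_
    refine mul_le_mul (le_abs_self C) (Real.rpow_le_rpow (abs_nonneg _) ?_ (by norm_num))
      (by positivity) (abs_nonneg _)
    rw [abs_sub_comm, abs_of_nonneg (by linarith [hξ.1])]
    linarith [hξ.2]
  refine hunif.continuousOn (Eventually.frequently (Eventually.of_forall fun n => ?_))
  refine ContinuousOn.div_const (ContinuousOn.sub ?_ hu) _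
  exact hu.comp (f := fun p : ℝ × ℝ => (p.1, p.2 + δ n)) (by fun_prop)
    fun p hp => ⟨hp.1, mem_univ _⟩

lemma InRegularityClass.isC1Periodic (h : InRegularityClass L T u D) : IsC1Periodic L T u :=
  ⟨h.periodic, h.differentiable, h.continuousOn, h.continuousOn_deriv⟩

lemma IsC1Periodic.exists_bound (h : IsC1Periodic L T u) :
    ∃ M : ℝ, ∀ t ∈ Icc 0 T, ∀ x ∈ Icc 0 L, |u t x| ≤ M ∧ |deriv (u t) x| ≤ M := by
  obtain ⟨M, hM⟩ := (isCompact_Icc.prod isCompact_Icc).exists_bound_of_continuousOn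
    (h.continuousOn.mono (prod_mono_right (t₁ := Icc 0 L) (subset_univ _)))
  obtain ⟨N, hN⟩ := (isCompact_Icc.prod isCompact_Icc).exists_bound_of_continuousOn
    (h.continuousOn_deriv.mono (prod_mono_right (t₁ := Icc 0 L) (subset_univ _)))
  exact ⟨max M N, fun t ht x hx => ⟨(hM (t, x) ⟨ht, hx⟩).trans (le_max_left _ _),
    (hN (t, x) ⟨ht, hx⟩).trans (le_max_right _ _)⟩⟩

lemma IsC1Periodic.exists_bound_inv (h : IsC1Periodic L T u)
    (hpos : ∀ t ∈ Icc 0 T, ∀ x, 0 < u t x) :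
    ∃ M : ℝ, ∀ t ∈ Icc 0 T, ∀ x ∈ Icc 0 L, (u t x)⁻¹ ≤ M := by
  obtain ⟨M, hM⟩ := (isCompact_Icc.prod isCompact_Icc).exists_bound_of_continuousOn
    ((h.continuousOn.mono (prod_mono_right (t₁ := Icc 0 L) (subset_univ _))).inv₀
      fun p hp => (hpos _ hp.1 _).ne')
  exact ⟨M, fun t ht x hx => (le_abs_self _).trans (hM (t, x) ⟨ht, hx⟩)⟩

end

/-! ### Pointwise estimates for the fluxes -/

/-- The height flux as a function of the jets of `h` and `c` at a point. -/
noncomputable def jetFlux (h c : ℕ → ℝ) : ℝ :=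
  h 0 ^ 3 * h 3 - h 1 / h 0 - h 0 ^ 2 * (h 1 * c 1 ^ 2 + 2 * h 0 * c 1 * c 2)

/-- `μ_x` as a function of the jets of `h` and `c` at a point. -/
noncomputable def jetPotential (h c : ℕ → ℝ) : ℝ :=
  (3 * c 0 ^ 2 - 1) * c 1 + h 1 ^ 2 * c 1 / h 0 ^ 2 - h 2 * c 1 / h 0 - h 1 * c 2 / h 0 - c 3

/-- The concentration flux as a function of the jets of `h` and `c` at a point. -/
noncomputable def jetConcFlux (h c : ℕ → ℝ) : ℝ :=
  c 0 * jetFlux h c - h 0 * jetPotential h c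

/-- Bounds for the jets of a solution at a point. -/
structure JetBound (M g : ℝ) (h c : ℕ → ℝ) : Prop where
  pos : 0 < h 0
  inv : (h 0)⁻¹ ≤ M
  h0 : |h 0| ≤ M
  h1 : |h 1| ≤ M
  c0 : |c 0| ≤ M
  c1 : |c 1| ≤ M
  h2 : |h 2| ≤ g
  h3 : |h 3| ≤ g
  c2 : |c 2| ≤ g
  c3 : |c 3| ≤ g

lemma abs_mul_le_mul {x y A B : ℝ} (hx : |x| ≤ A) (hy : |y| ≤ B) : |x * y| ≤ A * B := by
  rw [abs_mul]
  exact mul_le_mul hx hy (abs_nonneg _) ((abs_nonneg _).trans hx)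

/-- Product rule for differences. Nested applications bound the difference of two monomials factor
by factor. -/
lemma abs_mul_sub_mul_le {x x' y y' A B p q : ℝ} (hx : |x| ≤ A) (hy : |y'| ≤ B)
    (hp : |x - x'| ≤ p) (hq : |y - y'| ≤ q) : |x * y - x' * y'| ≤ A * q + p * B := by
  have e : x * y - x' * y' = x * (y - y') + (x - x') * y' := by ring
  rw [e]
  exact (abs_add_le _ _).trans (add_le_add (abs_mul_le_mul hx hq) (abs_mul_le_mul hp hy))

lemma abs_add_le_add {x y A B : ℝ} (hx : |x| ≤ A) (hy : |y| ≤ B) : |x + y| ≤ A + B :=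
  (abs_add_le _ _).trans (add_le_add hx hy)

lemma abs_sub_le_add {x y A B : ℝ} (hx : |x| ≤ A) (hy : |y| ≤ B) : |x - y| ≤ A + B :=
  (abs_sub _ _).trans (add_le_add hx hy)

/-- The sum of the absolute differences of the values and first derivatives. -/
def lowDiff (h c a b : ℕ → ℝ) : ℝ :=
  |h 0 - a 0| + |h 1 - a 1| + |c 0 - b 0| + |c 1 - b 1|

section

variable {M g : ℝ} {h c a b : ℕ → ℝ}

lemma lowDiff_nonneg (h c a b : ℕ → ℝ) : 0 ≤ lowDiff h c a b := by
  unfold lowDiff; positivity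

lemma lowDiff_bounds (h c a b : ℕ → ℝ) :
    |h 0 - a 0| ≤ lowDiff h c a b ∧ |h 1 - a 1| ≤ lowDiff h c a b ∧
      |c 0 - b 0| ≤ lowDiff h c a b ∧ |c 1 - b 1| ≤ lowDiff h c a b := by
  unfold lowDiff
  have h1 := abs_nonneg (h 0 - a 0)
  have h2 := abs_nonneg (h 1 - a 1)
  have h3 := abs_nonneg (c 0 - b 0)
  have h4 := abs_nonneg (c 1 - b 1)
  refine ⟨?_, ?_, ?_, ?_⟩ <;> linarith

lemma JetBound.abs_inv (hb : JetBound M g h c) : |(h 0)⁻¹| ≤ M := by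
  rw [abs_of_pos (inv_pos.2 hb.pos)]; exact hb.inv

lemma abs_inv_sub_inv_le (hb : JetBound M g h c) (hb' : JetBound M g a b) :
    |(h 0)⁻¹ - (a 0)⁻¹| ≤ M ^ 2 * lowDiff h c a b := by
  have e : (h 0)⁻¹ - (a 0)⁻¹ = ((h 0)⁻¹ * (a 0)⁻¹) * (-(h 0 - a 0)) := by
    have := hb.pos.ne'
    have := hb'.pos.ne'
    field_simp
    ring
  rw [e, pow_two]
  exact abs_mul_le_mul (abs_mul_le_mul hb.abs_inv hb'.abs_inv)
    (by rw [abs_neg]; exact (lowDiff_bounds h c a b).1)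

/-- Each monomial has at most one factor of order two or three, hence at most one power of g. The
factor 5 counts the four monomials, with the coefficient 2 of h c_x c_xx. -/
lemma abs_jetFlux_le (hM : 1 ≤ M) (hg : 1 ≤ g) (hb : JetBound M g h c) :
    |jetFlux h c| ≤ 5 * M ^ 5 * g := by
  have b3 : |h 0 ^ 3| ≤ M ^ 3 := by rw [abs_pow]; exact pow_le_pow_left₀ (abs_nonneg _) hb.h0 3
  have b2 : |h 0 ^ 2| ≤ M ^ 2 := by rw [abs_pow]; exact pow_le_pow_left₀ (abs_nonneg _) hb.h0 2
  have bc : |c 1 ^ 2| ≤ M ^ 2 := by rw [abs_pow]; exact pow_le_pow_left₀ (abs_nonneg _) hb.c1 2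
  have key := abs_sub_le_add (abs_sub_le_add (abs_mul_le_mul b3 hb.h3)
    (abs_mul_le_mul hb.h1 hb.abs_inv)) (abs_mul_le_mul b2 (abs_add_le_add
      (abs_mul_le_mul hb.h1 bc) (abs_mul_le_mul (abs_mul_le_mul (abs_mul_le_mul
        (abs_two.le) hb.h0) hb.c1) hb.c2)))
  rw [← div_eq_mul_inv] at key
  refine key.trans ?_
  have M0 : 0 ≤ M := by linarith
  have e3 : M ^ 3 ≤ M ^ 5 := pow_le_pow_right₀ hM (by norm_num)
  have e2 : M ^ 2 ≤ M ^ 5 := pow_le_pow_right₀ hM (by norm_num)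
  have e4 : M ^ 4 ≤ M ^ 5 := pow_le_pow_right₀ hM (by norm_num)
  calc M ^ 3 * g + M * M + M ^ 2 * (M * M ^ 2 + 2 * M * M * g)
      = M ^ 3 * g + M ^ 2 * 1 + (M ^ 5 * 1 + 2 * (M ^ 4 * g)) := by ring
    _ ≤ M ^ 5 * g + M ^ 5 * g + (M ^ 5 * g + 2 * (M ^ 5 * g)) := by gcongr
    _ = 5 * M ^ 5 * g := by ring

lemma abs_jetPotential_le (hM : 1 ≤ M) (hg : 1 ≤ g) (hb : JetBound M g h c) :
    |jetPotential h c| ≤ 8 * M ^ 5 * g := by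
  have b0 : |c 0 ^ 2| ≤ M ^ 2 := by rw [abs_pow]; exact pow_le_pow_left₀ (abs_nonneg _) hb.c0 2
  have b1 : |h 1 ^ 2| ≤ M ^ 2 := by rw [abs_pow]; exact pow_le_pow_left₀ (abs_nonneg _) hb.h1 2
  have bi : |(h 0)⁻¹ ^ 2| ≤ M ^ 2 := by
    rw [abs_pow]; exact pow_le_pow_left₀ (abs_nonneg _) hb.abs_inv 2
  have t3 : |(3 : ℝ)| ≤ 3 := by norm_num
  have t1 : |(1 : ℝ)| ≤ 1 := by norm_num
  have key := abs_sub_le_add (abs_sub_le_add (abs_sub_le_add (abs_add_le_add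
    (abs_mul_le_mul (abs_sub_le_add (abs_mul_le_mul t3 b0) t1) hb.c1)
    (abs_mul_le_mul (abs_mul_le_mul b1 hb.c1) bi))
    (abs_mul_le_mul (abs_mul_le_mul hb.h2 hb.c1) hb.abs_inv))
    (abs_mul_le_mul (abs_mul_le_mul hb.h1 hb.c2) hb.abs_inv)) hb.c3
  rw [inv_pow, ← div_eq_mul_inv, ← div_eq_mul_inv, ← div_eq_mul_inv] at key
  refine key.trans ?_
  have M0 : 0 ≤ M := by linarith
  have e3 : M ^ 3 ≤ M ^ 5 := pow_le_pow_right₀ hM (by norm_num)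
  have e2 : M ^ 2 ≤ M ^ 5 := pow_le_pow_right₀ hM (by norm_num)
  have e1 : M ≤ M ^ 5 := le_self_pow₀ hM (by norm_num)
  have e0 : 1 ≤ M ^ 5 := one_le_pow₀ hM
  calc (3 * M ^ 2 + 1) * M + M ^ 2 * M * M ^ 2 + g * M * M + M * g * M + g
      = 3 * (M ^ 3 * 1) + M * 1 + M ^ 5 * 1 + M ^ 2 * g + M ^ 2 * g + 1 * g := by ring
    _ ≤ 3 * (M ^ 5 * g) + M ^ 5 * g + M ^ 5 * g + M ^ 5 * g + M ^ 5 * g + M ^ 5 * g := by gcongr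
    _ = 8 * M ^ 5 * g := by ring

/-- The difference of the height fluxes, up to its leading term. -/
lemma abs_jetFlux_sub_le (hM : 1 ≤ M) (hg : 1 ≤ g) (hb : JetBound M g h c)
    (hb' : JetBound M g a b) :
    |jetFlux h c - jetFlux a b - h 0 ^ 3 * (h 3 - a 3)| ≤
      18 * M ^ 4 * (|c 2 - b 2| + g * lowDiff h c a b) := by
  obtain ⟨d0, d1, -, d3⟩ := lowDiff_bounds h c a b
  have s0 := lowDiff_nonneg h c a b
  have di := abs_inv_sub_inv_le hb hb'
  set s := lowDiff h c a b
  have p2 := abs_mul_sub_mul_le hb.h0 hb'.h0 d0 d0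
  have p3 := abs_mul_sub_mul_le hb.h0 (abs_mul_le_mul hb'.h0 hb'.h0) d0 p2
  have q2 := abs_mul_sub_mul_le hb.c1 hb'.c1 d3 d3
  have r1 := abs_mul_sub_mul_le hb.h1 (abs_mul_le_mul hb'.c1 hb'.c1) d1 q2
  have r2 := abs_mul_sub_mul_le (abs_mul_le_mul hb.h0 hb.h0)
    (abs_mul_le_mul hb'.h1 (abs_mul_le_mul hb'.c1 hb'.c1)) p2 r1
  have w := abs_mul_sub_mul_le hb.h1 hb'.abs_inv d1 di
  have v := abs_mul_sub_mul_le (abs_mul_le_mul hb.h0 (abs_mul_le_mul hb.h0 hb.h0)) hb'.c1 p3 d3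
  have z := abs_mul_le_mul (abs_mul_le_mul (abs_mul_le_mul hb.h0 (abs_mul_le_mul hb.h0 hb.h0))
    hb.c1) (le_refl |c 2 - b 2|)
  have key := abs_sub_le_add (abs_sub_le_add (abs_sub_le_add (abs_mul_le_mul p3 hb'.h3) w) r2)
    (abs_mul_le_mul abs_two.le (abs_add_le_add z (abs_mul_le_mul v hb'.c2)))
  -- The splitting puts differences of coefficients on the high derivatives `a 3` and `b 2`, which
  -- are bounded by g, and leaves the difference of second derivatives with a coefficient bounded in
  -- terms of M.
  have e : jetFlux h c - jetFlux a b - h 0 ^ 3 * (h 3 - a 3) =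
      (h 0 * (h 0 * h 0) - a 0 * (a 0 * a 0)) * a 3 - (h 1 * (h 0)⁻¹ - a 1 * (a 0)⁻¹) -
      (h 0 * h 0 * (h 1 * (c 1 * c 1)) - a 0 * a 0 * (a 1 * (b 1 * b 1))) -
      2 * (h 0 * (h 0 * h 0) * c 1 * (c 2 - b 2) +
        (h 0 * (h 0 * h 0) * c 1 - a 0 * (a 0 * a 0) * b 1) * b 2) := by
    unfold jetFlux
    rw [div_eq_mul_inv, div_eq_mul_inv]
    ring
  rw [e]
  refine key.trans ?_
  have M0 : 0 ≤ M := by linarith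
  have e3 : M ^ 3 ≤ M ^ 4 := pow_le_pow_right₀ hM (by norm_num)
  have e2 : M ^ 2 ≤ M ^ 4 := pow_le_pow_right₀ hM (by norm_num)
  have e1 : M ≤ M ^ 4 := le_self_pow₀ hM (by norm_num)
  have hs : 1 * s ≤ g * s := by gcongr
  have y0 := abs_nonneg (c 2 - b 2)
  calc _ = 3 * (M ^ 2 * (g * s)) + (M ^ 3 * (1 * s) + M * (1 * s)) + 5 * (M ^ 4 * (1 * s)) +
        2 * (M ^ 4 * |c 2 - b 2|) + 8 * (M ^ 3 * (g * s)) := by ring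
    _ ≤ 3 * (M ^ 4 * (g * s)) + (M ^ 4 * (g * s) + M ^ 4 * (g * s)) + 5 * (M ^ 4 * (g * s)) +
        2 * (M ^ 4 * |c 2 - b 2|) + 8 * (M ^ 4 * (g * s)) := by gcongr
    _ ≤ 18 * M ^ 4 * (|c 2 - b 2| + g * s) := by
      have : 0 ≤ M ^ 4 * |c 2 - b 2| := by positivity
      linarith

/-- The difference of the derivatives of the chemical potential, up to its leading term. -/
lemma abs_jetPotential_sub_le (hM : 1 ≤ M) (hg : 1 ≤ g) (hb : JetBound M g h c)
    (hb' : JetBound M g a b) :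
    |jetPotential h c - jetPotential a b + (c 3 - b 3)| ≤
      20 * M ^ 6 * (|h 2 - a 2| + |c 2 - b 2| + g * lowDiff h c a b) := by
  obtain ⟨d0, d1, d2, d3⟩ := lowDiff_bounds h c a b
  have s0 := lowDiff_nonneg h c a b
  have di := abs_inv_sub_inv_le hb hb'
  set s := lowDiff h c a b
  have t3 : |(3 : ℝ)| ≤ 3 := by norm_num
  have k1 := abs_mul_sub_mul_le (abs_mul_le_mul hb.c0 hb.c0) hb'.c1
    (abs_mul_sub_mul_le hb.c0 hb'.c0 d2 d2) d3
  have k2 := abs_mul_sub_mul_le hb.c1 hb'.abs_inv d3 di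
  have k3 := abs_mul_sub_mul_le hb.h1 hb'.abs_inv d1 di
  have k4 := abs_mul_sub_mul_le hb.h1 (abs_mul_le_mul hb'.c1 hb'.abs_inv) d1 k2
  have k5 := abs_mul_sub_mul_le (abs_mul_le_mul hb.h1 hb.abs_inv)
    (abs_mul_le_mul hb'.h1 (abs_mul_le_mul hb'.c1 hb'.abs_inv)) k3 k4
  have key := abs_sub_le_add (abs_sub_le_add (abs_add_le_add (abs_sub_le_add
    (abs_mul_le_mul t3 k1) d3) k5)
    (abs_add_le_add (abs_mul_le_mul (abs_mul_le_mul hb.c1 hb.abs_inv) (le_refl |h 2 - a 2|))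
      (abs_mul_le_mul k2 hb'.h2)))
    (abs_add_le_add (abs_mul_le_mul (abs_mul_le_mul hb.h1 hb.abs_inv) (le_refl |c 2 - b 2|))
      (abs_mul_le_mul k3 hb'.c2))
  have e : jetPotential h c - jetPotential a b + (c 3 - b 3) =
      3 * (c 0 * c 0 * c 1 - b 0 * b 0 * b 1) - (c 1 - b 1) +
      (h 1 * (h 0)⁻¹ * (h 1 * (c 1 * (h 0)⁻¹)) - a 1 * (a 0)⁻¹ * (a 1 * (b 1 * (a 0)⁻¹))) -
      (c 1 * (h 0)⁻¹ * (h 2 - a 2) + (c 1 * (h 0)⁻¹ - b 1 * (a 0)⁻¹) * a 2) -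
      (h 1 * (h 0)⁻¹ * (c 2 - b 2) + (h 1 * (h 0)⁻¹ - a 1 * (a 0)⁻¹) * b 2) := by
    unfold jetPotential
    simp only [div_eq_mul_inv, ← inv_pow]
    ring
  rw [e]
  refine key.trans ?_
  have M0 : 0 ≤ M := by linarith
  have e5 : M ^ 5 ≤ M ^ 6 := pow_le_pow_right₀ hM (by norm_num)
  have e4 : M ^ 4 ≤ M ^ 6 := pow_le_pow_right₀ hM (by norm_num)
  have e3 : M ^ 3 ≤ M ^ 6 := pow_le_pow_right₀ hM (by norm_num)
  have e2 : M ^ 2 ≤ M ^ 6 := pow_le_pow_right₀ hM (by norm_num)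
  have e1 : M ≤ M ^ 6 := le_self_pow₀ hM (by norm_num)
  have e0 : 1 ≤ M ^ 6 := one_le_pow₀ hM
  have hs : 1 * s ≤ g * s := by gcongr
  have y0 := abs_nonneg (c 2 - b 2)
  have x0 := abs_nonneg (h 2 - a 2)
  calc _ = 9 * (M ^ 2 * (1 * s)) + 1 * (1 * s) + (2 * (M ^ 6 * (1 * s)) + 3 * (M ^ 4 * (1 * s))) +
        (M ^ 2 * |h 2 - a 2| + (M ^ 3 + M) * (g * s)) +
        (M ^ 2 * |c 2 - b 2| + (M ^ 3 + M) * (g * s)) := by ring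
    _ ≤ 9 * (M ^ 6 * (g * s)) + M ^ 6 * (g * s) + (2 * (M ^ 6 * (g * s)) + 3 * (M ^ 6 * (g * s))) +
        (M ^ 6 * |h 2 - a 2| + (M ^ 6 + M ^ 6) * (g * s)) +
        (M ^ 6 * |c 2 - b 2| + (M ^ 6 + M ^ 6) * (g * s)) := by gcongr
    _ ≤ 20 * M ^ 6 * (|h 2 - a 2| + |c 2 - b 2| + g * s) := by
      have i1 : 0 ≤ M ^ 6 * |c 2 - b 2| := by positivity
      have i2 : 0 ≤ M ^ 6 * |h 2 - a 2| := by positivity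
      have i3 : 0 ≤ M ^ 6 * (g * s) := by positivity
      linarith

/-- The difference of the concentration fluxes, up to its leading terms. -/
lemma abs_jetConcFlux_sub_le (hM : 1 ≤ M) (hg : 1 ≤ g) (hb : JetBound M g h c)
    (hb' : JetBound M g a b) :
    |jetConcFlux h c - jetConcFlux a b - c 0 * h 0 ^ 3 * (h 3 - a 3) - h 0 * (c 3 - b 3)| ≤
      60 * M ^ 7 * (|h 2 - a 2| + |c 2 - b 2| + g * lowDiff h c a b) := by
  obtain ⟨d0, -, d2, -⟩ := lowDiff_bounds h c a b
  have s0 := lowDiff_nonneg h c a b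
  have key := abs_sub_le_add (abs_sub_le_add (abs_add_le_add
    (abs_mul_le_mul hb.c0 (abs_jetFlux_sub_le hM hg hb hb'))
    (abs_mul_le_mul d2 (abs_jetFlux_le hM hg hb')))
    (abs_mul_le_mul hb.h0 (abs_jetPotential_sub_le hM hg hb hb')))
    (abs_mul_le_mul d0 (abs_jetPotential_le hM hg hb'))
  set s := lowDiff h c a b
  have e : jetConcFlux h c - jetConcFlux a b - c 0 * h 0 ^ 3 * (h 3 - a 3) -
      h 0 * (c 3 - b 3) =
      c 0 * (jetFlux h c - jetFlux a b - h 0 ^ 3 * (h 3 - a 3)) + (c 0 - b 0) * jetFlux a b -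
      h 0 * (jetPotential h c - jetPotential a b + (c 3 - b 3)) -
      (h 0 - a 0) * jetPotential a b := by
    unfold jetConcFlux
    ring
  rw [e]
  refine key.trans ?_
  have M0 : 0 ≤ M := by linarith
  have e5 : M ^ 5 ≤ M ^ 7 := pow_le_pow_right₀ hM (by norm_num)
  have y0 := abs_nonneg (c 2 - b 2)
  have x0 := abs_nonneg (h 2 - a 2)
  calc _ = 18 * (M ^ 5 * (|c 2 - b 2| + g * s)) + 13 * (M ^ 5 * (g * s)) +
        20 * (M ^ 7 * (|h 2 - a 2| + |c 2 - b 2| + g * s)) := by ring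
    _ ≤ 18 * (M ^ 7 * (|c 2 - b 2| + g * s)) + 13 * (M ^ 7 * (g * s)) +
        20 * (M ^ 7 * (|h 2 - a 2| + |c 2 - b 2| + g * s)) := by gcongr
    _ ≤ 60 * M ^ 7 * (|h 2 - a 2| + |c 2 - b 2| + g * s) := by
      have i1 : 0 ≤ M ^ 7 * |c 2 - b 2| := by positivity
      have i2 : 0 ≤ M ^ 7 * |h 2 - a 2| := by positivity
      have i3 : 0 ≤ M ^ 7 * (g * s) := by positivity
      linarith

/-- The jet of the difference `c h - b a`. -/
def prodDiff (h c a b : ℕ → ℝ) (j : ℕ) : ℝ :=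
  match j with
  | 0 => c 0 * h 0 - b 0 * a 0
  | 1 => c 1 * h 0 + c 0 * h 1 - (b 1 * a 0 + b 0 * a 1)
  | _ => c 2 * h 0 + 2 * (c 1 * h 1) + c 0 * h 2 - (b 2 * a 0 + 2 * (b 1 * a 1) + b 0 * a 2)

lemma abs_prodDiff_one_le (hb : JetBound M g h c) (hb' : JetBound M g a b) :
    |prodDiff h c a b 1| ≤ 4 * M * lowDiff h c a b := by
  obtain ⟨d0, d1, d2, d3⟩ := lowDiff_bounds h c a b
  have e : prodDiff h c a b 1 = (c 1 * h 0 - b 1 * a 0) + (c 0 * h 1 - b 0 * a 1) := by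
    simp only [prodDiff]; ring
  rw [e]
  exact (abs_add_le_add (abs_mul_sub_mul_le hb.c1 hb'.h0 d3 d0)
    (abs_mul_sub_mul_le hb.c0 hb'.h1 d2 d1)).trans_eq (by ring)

/-- The factor g falls only on the undifferentiated differences. This is essential: a term g |η_x|
here would give g² η_x² after Young's inequality, and then g⁴ η² after interpolation, whose
coefficient need not be integrable in time. -/
lemma abs_prodDiff_two_sub_le (hb : JetBound M g h c) (hb' : JetBound M g a b) :
    |prodDiff h c a b 2 - h 0 * (c 2 - b 2) - c 0 * (h 2 - a 2)| ≤
      4 * M * lowDiff h c a b + g * (|h 0 - a 0| + |c 0 - b 0|) := by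
  obtain ⟨d0, d1, d2, d3⟩ := lowDiff_bounds h c a b
  have e : prodDiff h c a b 2 - h 0 * (c 2 - b 2) - c 0 * (h 2 - a 2) =
      2 * (c 1 * h 1 - b 1 * a 1) + (b 2 * (h 0 - a 0) + a 2 * (c 0 - b 0)) := by
    simp only [prodDiff]; ring
  rw [e]
  exact (abs_add_le_add (abs_mul_le_mul abs_two.le (abs_mul_sub_mul_le hb.c1 hb'.h1 d3 d1))
    (abs_add_le_add (abs_mul_le_mul hb'.c2 le_rfl) (abs_mul_le_mul hb'.h2 le_rfl))).trans_eq
      (by ring)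

/-- Coercivity of the leading part of the energy dissipation. -/
lemma leading_part_le (hM : 1 ≤ M) {p q X Y : ℝ} (hp : 0 < p) (hpi : p⁻¹ ≤ M) (hpM : |p| ≤ M)
    (hq : |q| ≤ M) :
    -(3 * M ^ 15 * p ^ 3 * X ^ 2) - q * p ^ 3 * (p * Y + q * X) * X - p * (p * Y + q * X) * Y ≤
      -(1 / (2 * M ^ 2)) * (X ^ 2 + Y ^ 2) := by
  have M0 : 0 < M := by linarith
  have hp1 : M⁻¹ ≤ p := by rw [inv_le_comm₀ M0 hp]; exact hpi
  -- Since p ≥ 1 / M, the choice Λ = 3 M^15 gives at least 3 M^12 X². Young's inequality spends 2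
  -- M^12 X² and half of the available Y² / M² on the cross term; the remaining M^12 X² exceeds X² /
  -- (2 M²). The term -q² p³ X² has a good sign.
  have a1 : 3 * M ^ 12 ≤ 3 * M ^ 15 * p ^ 3 := by
    calc 3 * M ^ 12 = 3 * M ^ 15 * M⁻¹ ^ 3 := by field_simp
      _ ≤ 3 * M ^ 15 * p ^ 3 := by gcongr
  have a2 : (M ^ 2)⁻¹ ≤ p ^ 2 := by
    rw [← inv_pow]; gcongr
  have a3 : |q * p ^ 4 + p * q| ≤ 2 * M ^ 5 := by
    have b4 : |p ^ 4| ≤ M ^ 4 := by rw [abs_pow]; exact pow_le_pow_left₀ (abs_nonneg _) hpM 4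
    refine (abs_add_le_add (abs_mul_le_mul hq b4) (abs_mul_le_mul hpM hq)).trans ?_
    have : M ^ 2 ≤ M ^ 5 := pow_le_pow_right₀ hM (by norm_num)
    calc M * M ^ 4 + M * M = M ^ 5 + M ^ 2 := by ring
      _ ≤ 2 * M ^ 5 := by linarith
  have a4 : -((q * p ^ 4 + p * q) * (X * Y)) ≤ 2 * M ^ 5 * (|X| * |Y|) := by
    have := abs_mul_le_mul a3 (le_refl |X * Y|)
    rw [abs_mul X Y] at this
    exact (neg_le_abs _).trans this
  have a5 : 2 * M ^ 5 * (|X| * |Y|) ≤ 2 * M ^ 12 * X ^ 2 + 1 / (2 * M ^ 2) * Y ^ 2 := by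
    have h0 : 0 ≤ (2 * M ^ 7 * |X| - |Y|) ^ 2 / (2 * M ^ 2) := by positivity
    have h1 : (2 * M ^ 7 * |X| - |Y|) ^ 2 / (2 * M ^ 2) =
        2 * M ^ 12 * |X| ^ 2 + 1 / (2 * M ^ 2) * |Y| ^ 2 - 2 * M ^ 5 * (|X| * |Y|) := by
      field_simp
      ring
    rw [h1, sq_abs, sq_abs] at h0
    linarith
  have a6 : 1 / (2 * M ^ 2) ≤ M ^ 12 := by
    rw [div_le_iff₀ (by positivity)]
    have : 1 ≤ M ^ 14 := one_le_pow₀ hM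
    nlinarith
  have a7 : (M ^ 2)⁻¹ = 1 / (2 * M ^ 2) + 1 / (2 * M ^ 2) := by field_simp; norm_num
  have X2 := sq_nonneg X
  have Y2 := sq_nonneg Y
  have b1 := mul_le_mul_of_nonneg_right a1 X2
  have b2 := mul_le_mul_of_nonneg_right a2 Y2
  have b3 := mul_le_mul_of_nonneg_right a6 X2
  have b4 : 0 ≤ q ^ 2 * p ^ 3 * X ^ 2 := by positivity
  rw [a7] at b2
  nlinarith

end

/-! ### The pointwise dissipation inequality -/

section

variable {M g : ℝ} {h c a b : ℕ → ℝ}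

/-- The derivative of the factor `P = Λ h³ η_x + c h³ ω_x` of `η_xxx` in the energy dissipation. -/
def heightFactorDeriv (Λ : ℝ) (h c a b : ℕ → ℝ) : ℝ :=
  Λ * ((h 2 - a 2) * h 0 ^ 3 + (h 1 - a 1) * (3 * h 0 ^ 2 * h 1)) +
    (prodDiff h c a b 2 * (c 0 * h 0 ^ 3) +
      prodDiff h c a b 1 * (c 1 * h 0 ^ 3 + c 0 * (3 * h 0 ^ 2 * h 1)))

/-- The derivative of the factor `Q = h ω_x` of `γ_xxx` in the energy dissipation. -/
def concFactorDeriv (h c a b : ℕ → ℝ) : ℝ :=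
  prodDiff h c a b 2 * h 0 + prodDiff h c a b 1 * h 1

/-- The energy dissipation density after integration by parts in the leading terms. -/
noncomputable def dissipation (Λ : ℝ) (h c a b : ℕ → ℝ) : ℝ :=
  -heightFactorDeriv Λ h c a b * (h 2 - a 2) - concFactorDeriv h c a b * (c 2 - b 2) +
    Λ * (h 1 - a 1) * (jetFlux h c - jetFlux a b - h 0 ^ 3 * (h 3 - a 3)) +
    prodDiff h c a b 1 * (jetConcFlux h c - jetConcFlux a b - c 0 * h 0 ^ 3 * (h 3 - a 3) -
      h 0 * (c 3 - b 3))

/-- Inserting ω_xx = h γ_xx + c η_xx + r isolates the form of `leading_part_le`. What remains is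
either a second-order difference times s + g z, or a product of two first-order bounds with one
factor g; here s collects orders zero and one, and z order zero alone. -/
lemma dissipation_le_aux (hM : 1 ≤ M) (hg : 1 ≤ g) (hb : JetBound M g h c)
    (hb' : JetBound M g a b) :
    dissipation (3 * M ^ 15) h c a b ≤
      -(1 / (2 * M ^ 2)) * ((h 2 - a 2) ^ 2 + (c 2 - b 2) ^ 2) +
        400 * M ^ 20 * ((|h 2 - a 2| + |c 2 - b 2|) *
          (lowDiff h c a b + g * (|h 0 - a 0| + |c 0 - b 0|)) +
          g * (lowDiff h c a b * lowDiff h c a b)) := by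
  obtain ⟨-, d1, -, -⟩ := lowDiff_bounds h c a b
  have s0 := lowDiff_nonneg h c a b
  have hlead := leading_part_le hM hb.pos hb.inv hb.h0 hb.c0 (X := h 2 - a 2) (Y := c 2 - b 2)
  have hRJ := abs_jetFlux_sub_le hM hg hb hb'
  have hRK := abs_jetConcFlux_sub_le hM hg hb hb'
  have hw := abs_prodDiff_one_le hb hb'
  have hr := abs_prodDiff_two_sub_le hb hb'
  set s := lowDiff h c a b
  set z := |h 0 - a 0| + |c 0 - b 0| with hz
  have z0 : 0 ≤ z := by positivity
  set RJ := jetFlux h c - jetFlux a b - h 0 ^ 3 * (h 3 - a 3) with hRJdef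
  set RK := jetConcFlux h c - jetConcFlux a b - c 0 * h 0 ^ 3 * (h 3 - a 3) - h 0 * (c 3 - b 3)
    with hRKdef
  set w := prodDiff h c a b 1 with hwdef
  set r := prodDiff h c a b 2 - h 0 * (c 2 - b 2) - c 0 * (h 2 - a 2) with hrdef
  have b3 : |h 0 ^ 3| ≤ M ^ 3 := by rw [abs_pow]; exact pow_le_pow_left₀ (abs_nonneg _) hb.h0 3
  have b2 : |h 0 ^ 2| ≤ M ^ 2 := by rw [abs_pow]; exact pow_le_pow_left₀ (abs_nonneg _) hb.h0 2
  have t3 : |(3 : ℝ)| ≤ 3 := by norm_num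
  have M0 : 0 ≤ M := by linarith
  have tΛ : |3 * M ^ 15| ≤ 3 * M ^ 15 := by rw [abs_of_nonneg (by positivity)]
  have b4 := abs_mul_le_mul (abs_mul_le_mul t3 b2) hb.h1
  have key := abs_add_le_add (abs_add_le_add (abs_add_le_add
    (abs_mul_le_mul (abs_add_le_add (abs_add_le_add (abs_mul_le_mul tΛ (abs_mul_le_mul d1 b4))
      (abs_mul_le_mul hr (abs_mul_le_mul hb.c0 b3)))
      (abs_mul_le_mul hw (abs_add_le_add (abs_mul_le_mul hb.c1 b3) (abs_mul_le_mul hb.c0 b4))))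
      (abs_neg (h 2 - a 2)).le)
    (abs_mul_le_mul (abs_add_le_add (abs_mul_le_mul hr hb.h0) (abs_mul_le_mul hw hb.h1))
      (abs_neg (c 2 - b 2)).le))
    (abs_mul_le_mul (abs_mul_le_mul tΛ d1) hRJ)) (abs_mul_le_mul hw hRK)
  have e : dissipation (3 * M ^ 15) h c a b =
      (-(3 * M ^ 15 * h 0 ^ 3 * (h 2 - a 2) ^ 2) -
        c 0 * h 0 ^ 3 * (h 0 * (c 2 - b 2) + c 0 * (h 2 - a 2)) * (h 2 - a 2) -
        h 0 * (h 0 * (c 2 - b 2) + c 0 * (h 2 - a 2)) * (c 2 - b 2)) +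
      ((3 * M ^ 15 * ((h 1 - a 1) * (3 * h 0 ^ 2 * h 1)) + r * (c 0 * h 0 ^ 3) +
        w * (c 1 * h 0 ^ 3 + c 0 * (3 * h 0 ^ 2 * h 1))) * -(h 2 - a 2) +
        (r * h 0 + w * h 1) * -(c 2 - b 2) +
        3 * M ^ 15 * (h 1 - a 1) * RJ + w * RK) := by
    unfold dissipation heightFactorDeriv concFactorDeriv
    rw [← hRJdef, ← hRKdef, ← hwdef, hrdef]
    ring
  rw [e]
  refine add_le_add hlead ((le_abs_self _).trans (key.trans ?_))
  have y0 := abs_nonneg (c 2 - b 2)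
  have x0 := abs_nonneg (h 2 - a 2)
  set X := |h 2 - a 2|
  set Y := |c 2 - b 2|
  have pw : ∀ k : ℕ, k ≤ 20 → M ^ k ≤ M ^ 20 := fun k hk => pow_le_pow_right₀ hM hk
  have p1 : M ≤ M ^ 20 := le_self_pow₀ hM (by norm_num)
  have p2 := pw 2 (by norm_num)
  have p4 := pw 4 (by norm_num)
  have p5 := pw 5 (by norm_num)
  have p8 := pw 8 (by norm_num)
  have p18 := pw 18 (by norm_num)
  have p19 := pw 19 (by norm_num)
  calc _ = (9 * M ^ 18 + 20 * M ^ 5 + 240 * M ^ 8) * (X * s) + M ^ 4 * (X * (g * z)) +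
        (8 * M ^ 2 + 54 * M ^ 19 + 240 * M ^ 8) * (Y * s) + M * (Y * (g * z)) +
        (54 * M ^ 19 + 240 * M ^ 8) * (g * (s * s)) := by ring
    _ ≤ (9 * M ^ 20 + 20 * M ^ 20 + 240 * M ^ 20) * (X * s) + M ^ 20 * (X * (g * z)) +
        (8 * M ^ 20 + 54 * M ^ 20 + 240 * M ^ 20) * (Y * s) + M ^ 20 * (Y * (g * z)) +
        (54 * M ^ 20 + 240 * M ^ 20) * (g * (s * s)) := by gcongr
    _ ≤ 400 * M ^ 20 * ((X + Y) * (s + g * z) + g * (s * s)) := by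
      have i1 : 0 ≤ M ^ 20 * (X * s) := by positivity
      have i2 : 0 ≤ M ^ 20 * (X * (g * z)) := by positivity
      have i3 : 0 ≤ M ^ 20 * (Y * s) := by positivity
      have i4 : 0 ≤ M ^ 20 * (Y * (g * z)) := by positivity
      have i5 : 0 ≤ M ^ 20 * (g * (s * s)) := by positivity
      linarith

lemma sq_lowDiff_le (h c a b : ℕ → ℝ) :
    lowDiff h c a b ^ 2 ≤ 4 * ((h 0 - a 0) ^ 2 + (c 0 - b 0) ^ 2 +
      ((h 1 - a 1) ^ 2 + (c 1 - b 1) ^ 2)) := by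
  unfold lowDiff
  rw [← sq_abs (h 0 - a 0), ← sq_abs (h 1 - a 1), ← sq_abs (c 0 - b 0), ← sq_abs (c 1 - b 1)]
  nlinarith [sq_nonneg (|h 0 - a 0| - |h 1 - a 1|), sq_nonneg (|h 0 - a 0| - |c 0 - b 0|),
    sq_nonneg (|h 0 - a 0| - |c 1 - b 1|), sq_nonneg (|h 1 - a 1| - |c 0 - b 0|),
    sq_nonneg (|h 1 - a 1| - |c 1 - b 1|), sq_nonneg (|c 0 - b 0| - |c 1 - b 1|)]

/-- The pointwise form of the energy estimate. -/
lemma dissipation_le (hM : 1 ≤ M) :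
    ∃ κ K : ℝ, 0 < κ ∧ 0 < K ∧ ∀ (g : ℝ) (h c a b : ℕ → ℝ), 1 ≤ g → JetBound M g h c →
      JetBound M g a b → dissipation (3 * M ^ 15) h c a b ≤
        -κ * ((h 2 - a 2) ^ 2 + (c 2 - b 2) ^ 2) +
          K * g * ((h 1 - a 1) ^ 2 + (c 1 - b 1) ^ 2) +
          K * g ^ 2 * ((h 0 - a 0) ^ 2 + (c 0 - b 0) ^ 2) := by
  have M0 : 0 < M := by linarith
  obtain ⟨κ, hκ⟩ : ∃ κ, κ = 1 / (2 * M ^ 2) := ⟨_, rfl⟩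
  obtain ⟨N, hN⟩ : ∃ N, N = 400 * M ^ 20 := ⟨_, rfl⟩
  have κ0 : 0 < κ := by rw [hκ]; positivity
  have N0 : 0 < N := by rw [hN]; positivity
  refine ⟨κ / 2, 12 * (N ^ 2 / κ + N), by positivity, by positivity, ?_⟩
  intro g h c a b hg hb hb'
  have main := dissipation_le_aux hM hg hb hb'
  have hs := sq_lowDiff_le h c a b
  rw [← hκ, ← hN] at main
  refine main.trans ?_
  set s := lowDiff h c a b
  set z := |h 0 - a 0| + |c 0 - b 0| with hz
  set X := |h 2 - a 2| with hX
  set Y := |c 2 - b 2| with hY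
  have eX : (h 2 - a 2) ^ 2 = X ^ 2 := (sq_abs _).symm
  have eY : (c 2 - b 2) ^ 2 = Y ^ 2 := (sq_abs _).symm
  have hz2 : z ^ 2 ≤ 2 * ((h 0 - a 0) ^ 2 + (c 0 - b 0) ^ 2) := by
    rw [hz, ← sq_abs (h 0 - a 0), ← sq_abs (c 0 - b 0)]
    linear_combination sq_nonneg (|h 0 - a 0| - |c 0 - b 0|)
  set n0 := (h 0 - a 0) ^ 2 + (c 0 - b 0) ^ 2 with hn0
  set n1 := (h 1 - a 1) ^ 2 + (c 1 - b 1) ^ 2 with hn1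
  have n00 : 0 ≤ n0 := by positivity
  have n10 : 0 ≤ n1 := by positivity
  rw [eX, eY]
  have g1 : g ≤ g ^ 2 := by nlinarith
  -- Half of the dissipation κ is spent on the second-order differences.
  have young : N * ((X + Y) * (s + g * z)) ≤
      κ / 2 * (X ^ 2 + Y ^ 2) + N ^ 2 / κ * (s + g * z) ^ 2 := by
    have h1 : 0 ≤ (κ / 2 * (X + Y) - N * (s + g * z)) ^ 2 / κ := by positivity
    have h2 : (κ / 2 * (X + Y) - N * (s + g * z)) ^ 2 / κ =
        κ / 4 * (X + Y) ^ 2 + N ^ 2 / κ * (s + g * z) ^ 2 - N * ((X + Y) * (s + g * z)) := by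
      field_simp
      ring
    have h3 : κ / 4 * (X + Y) ^ 2 ≤ κ / 4 * (2 * (X ^ 2 + Y ^ 2)) := by
      gcongr
      linear_combination sq_nonneg (X - Y)
    linarith
  -- The assumption g ≥ 1 puts everything in the form g n1 + g² n0, with only one power of g on the
  -- first-order part.
  have hW : (s + g * z) ^ 2 ≤ 12 * (g * n1 + g ^ 2 * n0) := by
    have h1 : (s + g * z) ^ 2 ≤ 2 * s ^ 2 + 2 * (g ^ 2 * z ^ 2) := by
      linear_combination sq_nonneg (s - g * z)
    have h2 : g ^ 2 * z ^ 2 ≤ g ^ 2 * (2 * n0) := by gcongr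
    have h3 : 1 * n1 ≤ g * n1 := by gcongr
    have h4 : 1 * n0 ≤ g ^ 2 * n0 := by gcongr; linarith
    have h5 : 0 ≤ g * n1 := by positivity
    linarith
  have hS : g * (s * s) ≤ 12 * (g * n1 + g ^ 2 * n0) := by
    have h1 : g * s ^ 2 ≤ g * (4 * (n0 + n1)) := by gcongr
    have h3 : g * n0 ≤ g ^ 2 * n0 := by gcongr
    have h4 : 0 ≤ g * n1 := by positivity
    have h5 : 0 ≤ g ^ 2 * n0 := by positivity
    have h6 : g * (s * s) = g * s ^ 2 := by ring
    linarith
  have i1 : N ^ 2 / κ * (s + g * z) ^ 2 ≤ N ^ 2 / κ * (12 * (g * n1 + g ^ 2 * n0)) := by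
    gcongr
  have i2 : N * (g * (s * s)) ≤ N * (12 * (g * n1 + g ^ 2 * n0)) := by gcongr
  linear_combination young + i1 + i2

end

/-! ### Integration by parts in space at a fixed time -/

/-- The integrand of the energy dissipation. -/
noncomputable def powerDensity (Λ : ℝ) (h c a b : ℕ → ℝ) : ℝ :=
  Λ * ((h 1 - a 1) * (jetFlux h c - jetFlux a b)) +
    prodDiff h c a b 1 * (jetConcFlux h c - jetConcFlux a b)

section

variable {L M g : ℝ} {h c a b : ℕ → ℝ → ℝ}

/-- The function whose derivative collects the boundary terms of the integrations by parts: those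
removing the third derivatives from `powerDensity`, and, with the weight `K`, those interpolating
the first derivatives of the differences between orders zero and two. -/
noncomputable def boundaryTerm (Λ K : ℝ) (h c a b : ℕ → ℝ → ℝ) (x : ℝ) : ℝ :=
  (Λ * ((h 1 x - a 1 x) * h 0 x ^ 3) +
    (c 1 x * h 0 x + c 0 x * h 1 x - (b 1 x * a 0 x + b 0 x * a 1 x)) * (c 0 x * h 0 x ^ 3)) *
      (h 2 x - a 2 x) +
    ((c 1 x * h 0 x + c 0 x * h 1 x - (b 1 x * a 0 x + b 0 x * a 1 x)) * h 0 x) *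
      (c 2 x - b 2 x) +
    K * ((h 0 x - a 0 x) * (h 1 x - a 1 x) + (c 0 x - b 0 x) * (c 1 x - b 1 x))

/-- The derivative of `boundaryTerm`. -/
noncomputable def boundaryTermDeriv (Λ K : ℝ) (h c a b : ℕ → ℝ) : ℝ :=
  heightFactorDeriv Λ h c a b * (h 2 - a 2) +
    (Λ * ((h 1 - a 1) * h 0 ^ 3) + prodDiff h c a b 1 * (c 0 * h 0 ^ 3)) * (h 3 - a 3) +
    concFactorDeriv h c a b * (c 2 - b 2) + prodDiff h c a b 1 * h 0 * (c 3 - b 3) +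
    K * ((h 1 - a 1) ^ 2 + (h 0 - a 0) * (h 2 - a 2) + (c 1 - b 1) ^ 2 +
      (c 0 - b 0) * (c 2 - b 2))

lemma hasDerivAt_boundaryTerm (hh : IsProfile L h) (hc : IsProfile L c) (ha : IsProfile L a)
    (hb : IsProfile L b) (Λ K : ℝ) {x : ℝ} (hx : x ∈ Ioo 0 L) :
    HasDerivAt (boundaryTerm Λ K h c a b)
      (boundaryTermDeriv Λ K (fun j => h j x) (fun j => c j x) (fun j => a j x)
        (fun j => b j x)) x := by
  have h0 := hh.hasDerivAt 0 (by norm_num) x hx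
  have h1 := hh.hasDerivAt 1 (by norm_num) x hx
  have h2 := hh.hasDerivAt 2 (by norm_num) x hx
  have c0 := hc.hasDerivAt 0 (by norm_num) x hx
  have c1 := hc.hasDerivAt 1 (by norm_num) x hx
  have c2 := hc.hasDerivAt 2 (by norm_num) x hx
  have a0 := ha.hasDerivAt 0 (by norm_num) x hx
  have a1 := ha.hasDerivAt 1 (by norm_num) x hx
  have a2 := ha.hasDerivAt 2 (by norm_num) x hx
  have b0 := hb.hasDerivAt 0 (by norm_num) x hx
  have b1 := hb.hasDerivAt 1 (by norm_num) x hx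
  have b2 := hb.hasDerivAt 2 (by norm_num) x hx
  simp only [zero_add, Nat.reduceAdd] at h0 h1 h2 c0 c1 c2 a0 a1 a2 b0 b1 b2
  have w := ((c1.fun_mul h0).fun_add (c0.fun_mul h1)).fun_sub
    ((b1.fun_mul a0).fun_add (b0.fun_mul a1))
  have p3 := h0.fun_pow 3
  have P := (((h1.fun_sub a1).fun_mul p3).const_mul Λ).fun_add (w.fun_mul (c0.fun_mul p3))
  have G := ((P.fun_mul (h2.fun_sub a2)).fun_add ((w.fun_mul h0).fun_mul (c2.fun_sub b2))).fun_add
    ((((h0.fun_sub a0).fun_mul (h1.fun_sub a1)).fun_add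
      ((c0.fun_sub b0).fun_mul (c1.fun_sub b1))).const_mul K)
  refine G.congr_deriv ?_
  simp only [boundaryTermDeriv, heightFactorDeriv, concFactorDeriv, prodDiff]
  push_cast
  ring

lemma continuousOn_boundaryTerm (hh : IsProfile L h) (hc : IsProfile L c) (ha : IsProfile L a)
    (hb : IsProfile L b) (Λ K : ℝ) :
    ContinuousOn (boundaryTerm Λ K h c a b) (Icc 0 L) := by
  have h0 := hh.cont 0 (by norm_num)
  have h1 := hh.cont 1 (by norm_num)
  have h2 := hh.cont 2 (by norm_num)
  have c0 := hc.cont 0 (by norm_num)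
  have c1 := hc.cont 1 (by norm_num)
  have c2 := hc.cont 2 (by norm_num)
  have a0 := ha.cont 0 (by norm_num)
  have a1 := ha.cont 1 (by norm_num)
  have a2 := ha.cont 2 (by norm_num)
  have b0 := hb.cont 0 (by norm_num)
  have b1 := hb.cont 1 (by norm_num)
  have b2 := hb.cont 2 (by norm_num)
  unfold boundaryTerm
  fun_prop

lemma continuousOn_boundaryTermDeriv (hh : IsProfile L h) (hc : IsProfile L c)
    (ha : IsProfile L a) (hb : IsProfile L b) (Λ K : ℝ) :
    ContinuousOn (fun x => boundaryTermDeriv Λ K (fun j => h j x) (fun j => c j x)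
      (fun j => a j x) (fun j => b j x)) (Icc 0 L) := by
  have h0 := hh.cont 0 (by norm_num)
  have h1 := hh.cont 1 (by norm_num)
  have h2 := hh.cont 2 (by norm_num)
  have h3 := hh.cont 3 (by norm_num)
  have c0 := hc.cont 0 (by norm_num)
  have c1 := hc.cont 1 (by norm_num)
  have c2 := hc.cont 2 (by norm_num)
  have c3 := hc.cont 3 (by norm_num)
  have a0 := ha.cont 0 (by norm_num)
  have a1 := ha.cont 1 (by norm_num)
  have a2 := ha.cont 2 (by norm_num)
  have a3 := ha.cont 3 (by norm_num)
  have b0 := hb.cont 0 (by norm_num)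
  have b1 := hb.cont 1 (by norm_num)
  have b2 := hb.cont 2 (by norm_num)
  have b3 := hb.cont 3 (by norm_num)
  simp only [boundaryTermDeriv, heightFactorDeriv, concFactorDeriv, prodDiff]
  fun_prop

/-- The primitive involves derivatives of order at most two, and these agree at the two ends of the
period. -/
lemma integral_boundaryTermDeriv (hL : 0 < L) (hh : IsProfile L h) (hc : IsProfile L c)
    (ha : IsProfile L a) (hb : IsProfile L b) (Λ K : ℝ) :
    ∫ x in (0 : ℝ)..L, boundaryTermDeriv Λ K (fun j => h j x) (fun j => c j x)
      (fun j => a j x) (fun j => b j x) = 0 := by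
  have hcont := continuousOn_boundaryTermDeriv hh hc ha hb Λ K
  rw [← uIcc_of_le hL.le] at hcont
  rw [intervalIntegral.integral_eq_sub_of_hasDerivAt_of_le hL.le
    (continuousOn_boundaryTerm hh hc ha hb Λ K)
    (fun x hx => hasDerivAt_boundaryTerm hh hc ha hb Λ K hx) hcont.intervalIntegrable]
  simp only [boundaryTerm, hh.endpoint 0 (by norm_num), hh.endpoint 1 (by norm_num),
    hh.endpoint 2 (by norm_num), hc.endpoint 0 (by norm_num), hc.endpoint 1 (by norm_num),
    hc.endpoint 2 (by norm_num), ha.endpoint 0 (by norm_num), ha.endpoint 1 (by norm_num),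
    ha.endpoint 2 (by norm_num), hb.endpoint 0 (by norm_num), hb.endpoint 1 (by norm_num),
    hb.endpoint 2 (by norm_num), sub_self]

lemma continuousOn_jetFlux (hh : IsProfile L h) (hc : IsProfile L c)
    (hpos : ∀ x ∈ Icc 0 L, h 0 x ≠ 0) :
    ContinuousOn (fun x => jetFlux (fun j => h j x) (fun j => c j x)) (Icc 0 L) := by
  have h0 := hh.cont 0 (by norm_num)
  have h1 := hh.cont 1 (by norm_num)
  have h3 := hh.cont 3 (by norm_num)
  have c1 := hc.cont 1 (by norm_num)
  have c2 := hc.cont 2 (by norm_num)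
  have d1 := h1.div h0 hpos
  unfold jetFlux
  exact ((h0.pow 3).mul h3).sub d1 |>.sub (by fun_prop)

lemma continuousOn_jetConcFlux (hh : IsProfile L h) (hc : IsProfile L c)
    (hpos : ∀ x ∈ Icc 0 L, h 0 x ≠ 0) :
    ContinuousOn (fun x => jetConcFlux (fun j => h j x) (fun j => c j x)) (Icc 0 L) := by
  have hJ := continuousOn_jetFlux hh hc hpos
  have h0 := hh.cont 0 (by norm_num)
  have h1 := hh.cont 1 (by norm_num)
  have h2 := hh.cont 2 (by norm_num)
  have c0 := hc.cont 0 (by norm_num)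
  have c1 := hc.cont 1 (by norm_num)
  have c2 := hc.cont 2 (by norm_num)
  have c3 := hc.cont 3 (by norm_num)
  have hi := h0.inv₀ hpos
  simp only [jetConcFlux, jetPotential, div_eq_mul_inv, ← inv_pow]
  fun_prop

lemma continuousOn_powerDensity (hh : IsProfile L h) (hc : IsProfile L c)
    (ha : IsProfile L a) (hb : IsProfile L b) (hpos : ∀ x ∈ Icc 0 L, h 0 x ≠ 0)
    (hpos' : ∀ x ∈ Icc 0 L, a 0 x ≠ 0) (Λ : ℝ) :
    ContinuousOn (fun x => powerDensity Λ (fun j => h j x) (fun j => c j x)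
      (fun j => a j x) (fun j => b j x)) (Icc 0 L) := by
  have := continuousOn_jetFlux hh hc hpos
  have := continuousOn_jetFlux ha hb hpos'
  have := continuousOn_jetConcFlux hh hc hpos
  have := continuousOn_jetConcFlux ha hb hpos'
  have h0 := hh.cont 0 (by norm_num)
  have h1 := hh.cont 1 (by norm_num)
  have c0 := hc.cont 0 (by norm_num)
  have c1 := hc.cont 1 (by norm_num)
  have a0 := ha.cont 0 (by norm_num)
  have a1 := ha.cont 1 (by norm_num)
  have b0 := hb.cont 0 (by norm_num)
  have b1 := hb.cont 1 (by norm_num)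
  simp only [powerDensity, prodDiff]
  fun_prop

/-- The energy dissipation estimate at a fixed time. -/
lemma integral_powerDensity_le (hL : 0 < L) (hM : 1 ≤ M) :
    ∃ K : ℝ, 0 < K ∧ ∀ (g : ℝ) (h c a b : ℕ → ℝ → ℝ), 1 ≤ g →
      IsProfile L h → IsProfile L c → IsProfile L a → IsProfile L b →
      (∀ x ∈ Icc 0 L, JetBound M g (fun j => h j x) (fun j => c j x)) →
      (∀ x ∈ Icc 0 L, JetBound M g (fun j => a j x) (fun j => b j x)) →
      ∫ x in (0 : ℝ)..L, powerDensity (3 * M ^ 15) (fun j => h j x) (fun j => c j x)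
        (fun j => a j x) (fun j => b j x) ≤
      K * g ^ 2 * ∫ x in (0 : ℝ)..L, ((h 0 x - a 0 x) ^ 2 + (c 0 x - b 0 x) ^ 2) := by
  obtain ⟨κ, K, hκ, hK, hD⟩ := dissipation_le hM
  -- The second summand is the price of interpolation: Young's inequality for -K g η η_xx against κ
  -- η_xx².
  refine ⟨K + K ^ 2 / (4 * κ), by positivity, ?_⟩
  intro g h c a b hg hh hc ha hb hB hB'
  have hpos : ∀ x ∈ Icc 0 L, h 0 x ≠ 0 := fun x hx => (hB x hx).pos.ne'
  have hpos' : ∀ x ∈ Icc 0 L, a 0 x ≠ 0 := fun x hx => (hB' x hx).pos.ne'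
  have hI := continuousOn_powerDensity hh hc ha hb hpos hpos' (3 * M ^ 15)
  -- With the weight K g the exact derivative contains K g (η_x² + γ_x²), cancelling the first-order
  -- part of `dissipation_le`.
  have hG := continuousOn_boundaryTermDeriv hh hc ha hb (3 * M ^ 15) (K * g)
  have hN : ContinuousOn (fun x => (K + K ^ 2 / (4 * κ)) * g ^ 2 *
      ((h 0 x - a 0 x) ^ 2 + (c 0 x - b 0 x) ^ 2)) (Icc 0 L) := by
    have h0 := hh.cont 0 (by norm_num)
    have c0 := hc.cont 0 (by norm_num)
    have a0 := ha.cont 0 (by norm_num)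
    have b0 := hb.cont 0 (by norm_num)
    fun_prop
  rw [← uIcc_of_le hL.le] at hI hG hN
  have hmono := intervalIntegral.integral_mono_on hL.le hI.intervalIntegrable (μ := volume)
    (hG.add hN).intervalIntegrable (fun x hx => ?_)
  · refine hmono.trans_eq ?_
    simp only [Pi.add_apply]
    rw [intervalIntegral.integral_add hG.intervalIntegrable hN.intervalIntegrable,
      integral_boundaryTermDeriv hL hh hc ha hb, zero_add, intervalIntegral.integral_const_mul]
  · have key := hD g _ _ _ _ hg (hB x hx) (hB' x hx)
    have e : powerDensity (3 * M ^ 15) (fun j => h j x) (fun j => c j x) (fun j => a j x)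
        (fun j => b j x) = boundaryTermDeriv (3 * M ^ 15) (K * g) (fun j => h j x)
          (fun j => c j x) (fun j => a j x) (fun j => b j x) +
        (dissipation (3 * M ^ 15) (fun j => h j x) (fun j => c j x) (fun j => a j x)
          (fun j => b j x) - K * g * ((h 1 x - a 1 x) ^ 2 + (h 0 x - a 0 x) * (h 2 x - a 2 x) +
            (c 1 x - b 1 x) ^ 2 + (c 0 x - b 0 x) * (c 2 x - b 2 x))) := by
      unfold powerDensity boundaryTermDeriv dissipation
      ring
    rw [e]
    refine add_le_add_right ?_ _
    have young : ∀ p q : ℝ, -(K * g * (p * q)) ≤ κ * q ^ 2 + K ^ 2 / (4 * κ) * g ^ 2 * p ^ 2 := by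
      intro p q
      have h0 : 0 ≤ (2 * κ * q + K * g * p) ^ 2 / (4 * κ) := by positivity
      have h1 : (2 * κ * q + K * g * p) ^ 2 / (4 * κ) =
          κ * q ^ 2 + K ^ 2 / (4 * κ) * g ^ 2 * p ^ 2 + K * g * (p * q) := by
        field_simp
        ring
      linarith
    linear_combination key + young (h 0 x - a 0 x) (h 2 x - a 2 x) +
      young (c 0 x - b 0 x) (c 2 x - b 2 x)

end

/-! ### Grönwall's inequality -/

/-- Grönwall's inequality in integral form, with an integrable coefficient. -/
lemma eq_zero_of_le_integral_mul {T : ℝ} {E α : ℝ → ℝ} (hT : 0 ≤ T)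
    (hE : ContinuousOn E (Icc 0 T)) (hE0 : ∀ t ∈ Icc 0 T, 0 ≤ E t)
    (hα : IntervalIntegrable α volume 0 T) (hα0 : ∀ t, 0 ≤ α t)
    (h : ∀ t ∈ Icc 0 T, E t ≤ ∫ s in (0 : ℝ)..t, α s * E s) :
    ∀ t ∈ Icc 0 T, E t = 0 := by
  have hA := intervalIntegral.continuousOn_primitive_interval' hα left_mem_uIcc
  rw [uIcc_of_le hT] at hA
  have hunif := isCompact_Icc.uniformContinuousOn_of_continuous hA
  rw [Metric.uniformContinuousOn_iff] at hunif
  -- The integral of α over an interval shorter than δ is below 1/2. Time is then covered by steps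
  -- of length δ / 2.
  obtain ⟨δ, hδ, hAδ⟩ := hunif (1 / 2) (by norm_num)
  have h0T : (0 : ℝ) ∈ Icc 0 T := ⟨le_rfl, hT⟩
  have sub : ∀ {G : ℝ → ℝ}, IntervalIntegrable G volume 0 T → ∀ s ∈ Icc 0 T, ∀ t ∈ Icc 0 T,
      IntervalIntegrable G volume s t := fun hG s hs t ht => hG.mono_set (by
    rw [uIcc_of_le hT]; exact uIcc_subset_Icc hs ht)
  have hαE : IntervalIntegrable (fun s => α s * E s) volume 0 T :=
    hα.mul_continuousOn (by rwa [uIcc_of_le hT])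
  have key : ∀ n : ℕ, ∀ t ∈ Icc 0 T, t ≤ n * (δ / 2) → E t = 0 := by
    intro n
    induction n with
    | zero =>
      intro t ht h'
      have e : t = 0 := le_antisymm (by simpa using h') ht.1
      have h1 := h 0 h0T
      rw [intervalIntegral.integral_same] at h1
      rw [e]
      exact le_antisymm h1 (hE0 0 h0T)
    | succ n ih =>
      intro t ht h'
      push_cast at h'
      have hsub : Icc 0 t ⊆ Icc 0 T := Icc_subset_Icc_right ht.2
      -- At a maximum point r of E on [0, t] lying beyond the region already treated, the inequality
      -- reads E r ≤ E r / 2.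
      obtain ⟨r, hr, hmax⟩ := isCompact_Icc.exists_isMaxOn (nonempty_Icc.2 ht.1) (hE.mono hsub)
      have hrT := hsub hr
      have hr0 : E r = 0 := by
        rcases le_or_gt r (n * (δ / 2)) with hrn | hrn
        · exact ih r hrT hrn
        set s : ℝ := n * (δ / 2) with hs
        have hs0 : 0 ≤ s := by positivity
        have hsT : s ∈ Icc 0 T := ⟨hs0, hrn.le.trans hrT.2⟩
        have e1 : ∫ τ in (0 : ℝ)..s, α τ * E τ = 0 := by
          rw [intervalIntegral.integral_congr (g := fun _ => (0 : ℝ))]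
          · simp
          · intro τ hτ
            rw [uIcc_of_le hs0] at hτ
            simp only [ih τ ⟨hτ.1, hτ.2.trans hsT.2⟩ hτ.2, mul_zero]
        have e2 : ∫ τ in s..r, α τ * E τ ≤ ∫ τ in s..r, α τ * E r :=
          intervalIntegral.integral_mono_on hrn.le (sub hαE s hsT r hrT)
            ((sub hα s hsT r hrT).mul_const _) fun τ hτ =>
            mul_le_mul_of_nonneg_left (hmax ⟨hs0.trans hτ.1, hτ.2.trans hr.2⟩) (hα0 τ)
        rw [intervalIntegral.integral_mul_const] at e2
        have e3 : ∫ τ in s..r, α τ ≤ 1 / 2 := by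
          have := hAδ r hrT s hsT (by
            rw [Real.dist_eq, abs_of_pos (by linarith)]
            linarith [hr.2])
          rw [Real.dist_eq, intervalIntegral.integral_interval_sub_left (sub hα 0 h0T r hrT)
            (sub hα 0 h0T s hsT)] at this
          exact (le_abs_self _).trans this.le
        have e4 := h r hrT
        rw [← intervalIntegral.integral_add_adjacent_intervals (sub hαE 0 h0T s hsT)
          (sub hαE s hsT r hrT), e1, zero_add] at e4
        have e5 := mul_le_mul_of_nonneg_right e3 (hE0 r hrT)
        linarith [hE0 r hrT]
      have h1 : E t ≤ E r := hmax ⟨ht.1, le_rfl⟩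
      exact le_antisymm (h1.trans hr0.le) (hE0 t ht)
  intro t ht
  obtain ⟨n, hn⟩ := exists_nat_ge (t / (δ / 2))
  exact key n t ht ((div_le_iff₀ (half_pos hδ)).1 hn)

/-! ### Time slices of a solution and integrability of the fluxes -/

section

variable {L T : ℝ} {u h c : ℝ → ℝ → ℝ} {D H C : ℕ → ℝ → ℝ → ℝ}

lemma InRegularityClass.aemeasurable_sobolevSq (hD : InRegularityClass L T u D) :
    AEMeasurable (sobolevSq L 4 D) (volume.restrict (Ioo 0 T)) := by
  unfold sobolevSq
  refine Finset.aemeasurable_fun_sum _ fun j hj => ?_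
  have hj' : j ≤ 4 := Nat.lt_succ_iff.1 (Finset.mem_range.1 hj)
  exact ((hD.aestronglyMeasurable j hj').enorm.pow_const 2).lintegral_prod_right'

lemma InRegularityClass.integrable_sobolevSq (hD : InRegularityClass L T u D) :
    Integrable (fun t => (sobolevSq L 4 D t).toReal) (volume.restrict (Ioo 0 T)) :=
  integrable_toReal_of_lintegral_ne_top hD.aemeasurable_sobolevSq hD.l2_W42.ne

lemma sq_integrable_of_sobolevSq_lt_top (hL : 0 < L) {t : ℝ} (ht : sobolevSq L 4 D t < ⊤) {j : ℕ}
    (hj : j ≤ 4) (hi : IntervalIntegrable (D j t) volume 0 L) :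
    IntervalIntegrable (fun x => D j t x ^ 2) volume 0 L ∧
      ∫ x in (0 : ℝ)..L, D j t x ^ 2 ≤ (sobolevSq L 4 D t).toReal := by
  rw [intervalIntegrable_iff_Ioo hL.le] at hi
  have hle : ∫⁻ x in Ioo 0 L, ‖D j t x‖ₑ ^ 2 ≤ sobolevSq L 4 D t := by
    unfold sobolevSq
    exact Finset.single_le_sum (f := fun j => ∫⁻ x in Ioo 0 L, ‖D j t x‖ₑ ^ 2)
      (fun _ _ => zero_le) (Finset.mem_range.2 (by omega))
  have e : ∀ x, ‖D j t x‖ₑ ^ 2 = ENNReal.ofReal (D j t x ^ 2) := fun x => by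
    rw [← enorm_pow, Real.enorm_eq_ofReal (sq_nonneg _)]
  simp only [e] at hle
  have hm : AEStronglyMeasurable (fun x => D j t x ^ 2) (volume.restrict (Ioo 0 L)) :=
    hi.aestronglyMeasurable.pow 2
  constructor
  · rw [intervalIntegrable_iff_Ioo hL.le]
    refine ⟨hm, ?_⟩
    rw [hasFiniteIntegral_iff_ofReal (Eventually.of_forall fun x => sq_nonneg _)]
    exact hle.trans_lt ht
  · rw [intervalIntegral_eq_Ioo hL.le, integral_eq_lintegral_of_nonneg_ae
      (Eventually.of_forall fun x => sq_nonneg _) hm]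
    exact ENNReal.toReal_mono ht.ne hle

/-- At almost every time, a function of the regularity class is a `C³` function of space. -/
lemma InRegularityClass.ae_exists_profile (hL : 0 < L) (hD : InRegularityClass L T u D) :
    ∀ᵐ t ∂volume.restrict (Ioo 0 T), ∃ v : ℕ → ℝ → ℝ, IsProfile L v ∧ v 0 = u t ∧
      v 1 = deriv (u t) ∧ (∀ j ≤ 3, ∀ᵐ x ∂volume.restrict (Ioo 0 L), D j t x = v j x) ∧
      ∀ x ∈ Icc 0 L, v 2 x ^ 2 ≤ (2 / L + 2 * L) * (sobolevSq L 4 D t).toReal ∧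
        v 3 x ^ 2 ≤ (2 / L + 2 * L) * (sobolevSq L 4 D t).toReal := by
  have hw : ∀ᵐ t ∂volume.restrict (Ioo 0 T), ∀ j < 4,
      HasPeriodicWeakDeriv L (D j t) (D (j + 1) t) := by
    rw [ae_all_iff]
    intro j
    by_cases hj : j < 4
    · filter_upwards [hD.weakDeriv j hj] with t ht _ using ht
    · exact Eventually.of_forall fun _ h => absurd h hj
  filter_upwards [hw, ae_lt_top' hD.aemeasurable_sobolevSq hD.l2_W42.ne,
    ae_restrict_mem measurableSet_Ioo] with t h1 h2 h3
  have ht := Ioo_subset_Icc_self h3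
  have hi : ∀ j ≤ 4, IntervalIntegrable (D j t) volume 0 L := by
    intro j hj
    rcases j with _ | j
    · exact (h1 0 (by norm_num)).1
    · exact (h1 j (by omega)).2.1
  exact exists_profile hL (hD.differentiable t ht) (hD.isC1Periodic.continuous_deriv ht)
    (congrFun hD.zero t) h1 (fun j hj => (sq_integrable_of_sobolevSq_lt_top hL h2 hj (hi j hj)).1)
    (fun j hj => (sq_integrable_of_sobolevSq_lt_top hL h2 hj (hi j hj)).2) (hD.periodic t ht)

lemma JetBound.mono {M M' g g' : ℝ} {p q : ℕ → ℝ} (hb : JetBound M g p q) (hM : M ≤ M')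
    (hg : g ≤ g') : JetBound M' g' p q :=
  ⟨hb.pos, hb.inv.trans hM, hb.h0.trans hM, hb.h1.trans hM, hb.c0.trans hM, hb.c1.trans hM,
    hb.h2.trans hg, hb.h3.trans hg, hb.c2.trans hg, hb.c3.trans hg⟩

/-- `p` and `q` are smooth representatives of the spatial derivatives `H j t` and `C j t`, with
bounds. -/
structure IsSlice (L M g : ℝ) (h c : ℝ → ℝ) (H C p q : ℕ → ℝ → ℝ) : Prop where
  profile_left : IsProfile L p
  profile_right : IsProfile L q
  left_zero : p 0 = h
  left_one : p 1 = deriv h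
  right_zero : q 0 = c
  right_one : q 1 = deriv c
  ae_left : ∀ j ≤ 3, ∀ᵐ x ∂volume.restrict (Ioo 0 L), H j x = p j x
  ae_right : ∀ j ≤ 3, ∀ᵐ x ∂volume.restrict (Ioo 0 L), C j x = q j x
  bound : ∀ x ∈ Icc 0 L, JetBound M g (fun j => p j x) (fun j => q j x)

/-- The square of the bound for the second and third spatial derivatives. -/
noncomputable def sliceSq (L : ℝ) (H C : ℕ → ℝ → ℝ → ℝ) (t : ℝ) : ℝ :=
  1 + (2 / L + 2 * L) * ((sobolevSq L 4 H t).toReal + (sobolevSq L 4 C t).toReal)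

/-- The summand 1 in `sliceSq` makes g = √`sliceSq` at least 1, as the pointwise estimates require.
-/
lemma one_le_sliceSq (hL : 0 < L) (H C : ℕ → ℝ → ℝ → ℝ) (t : ℝ) : 1 ≤ sliceSq L H C t := by
  have : 0 ≤ (2 / L + 2 * L) * ((sobolevSq L 4 H t).toReal + (sobolevSq L 4 C t).toReal) := by
    positivity
  unfold sliceSq
  linarith

/-- This is where the L²(0,T;W^{4,2}) bound enters: it makes g² an integrable Grönwall coefficient.
-/
lemma integrable_sliceSq (hH : InRegularityClass L T h H) (hC : InRegularityClass L T c C) :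
    Integrable (sliceSq L H C) (volume.restrict (Ioo 0 T)) :=
  (integrable_const _).add
    ((hH.integrable_sobolevSq.add hC.integrable_sobolevSq).const_mul _)

/-- M does not depend on time: it comes from compactness of [0, T] × [0, L], continuity of h, c,
h_x, c_x, and positivity of h. Only the bound for orders two and three varies with t. -/
lemma exists_isSlice (hL : 0 < L) (hH : InRegularityClass L T h H)
    (hC : InRegularityClass L T c C) (hpos : ∀ t ∈ Icc 0 T, ∀ x, 0 < h t x) :
    ∃ M, 1 ≤ M ∧ ∀ᵐ t ∂volume.restrict (Ioo 0 T), ∃ p q : ℕ → ℝ → ℝ,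
      IsSlice L M √(sliceSq L H C t) (h t) (c t) (fun j => H j t) (fun j => C j t) p q := by
  obtain ⟨M1, h1⟩ := hH.isC1Periodic.exists_bound
  obtain ⟨M2, h2⟩ := hC.isC1Periodic.exists_bound
  obtain ⟨M3, h3⟩ := hH.isC1Periodic.exists_bound_inv hpos
  refine ⟨max (max 1 M1) (max M2 M3), (le_max_left _ _).trans (le_max_left _ _), ?_⟩
  filter_upwards [hH.ae_exists_profile hL, hC.ae_exists_profile hL,
    ae_restrict_mem measurableSet_Ioo] with t ⟨p, pp, p0, p1, pa, pb⟩ ⟨q, qp, q0, q1, qa, qb⟩ ht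
  have ht' := Ioo_subset_Icc_self ht
  have hB : 0 ≤ (sobolevSq L 4 H t).toReal := ENNReal.toReal_nonneg
  have hB' : 0 ≤ (sobolevSq L 4 C t).toReal := ENNReal.toReal_nonneg
  have m1 : M1 ≤ max (max 1 M1) (max M2 M3) := (le_max_right _ _).trans (le_max_left _ _)
  have m2 : M2 ≤ max (max 1 M1) (max M2 M3) := (le_max_left _ _).trans (le_max_right _ _)
  have m3 : M3 ≤ max (max 1 M1) (max M2 M3) := (le_max_right _ _).trans (le_max_right _ _)
  have k0 : 0 ≤ (2 / L + 2 * L) * (sobolevSq L 4 H t).toReal := by positivity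
  have k1 : 0 ≤ (2 / L + 2 * L) * (sobolevSq L 4 C t).toReal := by positivity
  have gl : ∀ y : ℝ, y ^ 2 ≤ (2 / L + 2 * L) * (sobolevSq L 4 H t).toReal →
      |y| ≤ √(sliceSq L H C t) := fun y hy => Real.abs_le_sqrt (by unfold sliceSq; linarith)
  have gr : ∀ y : ℝ, y ^ 2 ≤ (2 / L + 2 * L) * (sobolevSq L 4 C t).toReal →
      |y| ≤ √(sliceSq L H C t) := fun y hy => Real.abs_le_sqrt (by unfold sliceSq; linarith)
  refine ⟨p, q, pp, qp, p0, p1, q0, q1, pa, qa, fun x hx => ?_⟩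
  constructor
  · simpa only [p0] using hpos t ht' x
  · simpa only [p0] using (h3 t ht' x hx).trans m3
  · simpa only [p0] using (h1 t ht' x hx).1.trans m1
  · simpa only [p1] using (h1 t ht' x hx).2.trans m1
  · simpa only [q0] using (h2 t ht' x hx).1.trans m2
  · simpa only [q1] using (h2 t ht' x hx).2.trans m2
  · exact gl _ (pb x hx).1
  · exact gl _ (pb x hx).2
  · exact gr _ (qb x hx).1
  · exact gr _ (qb x hx).2

lemma IsSlice.ae_heightFlux {M g t : ℝ} {p q : ℕ → ℝ → ℝ}
    (hs : IsSlice L M g (h t) (c t) (fun j => H j t) (fun j => C j t) p q) :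
    ∀ᵐ x ∂volume.restrict (Ioo 0 L),
      heightFlux H C t x = jetFlux (fun j => p j x) (fun j => q j x) := by
  filter_upwards [hs.ae_left 0 (by norm_num), hs.ae_left 1 (by norm_num),
    hs.ae_left 3 (by norm_num), hs.ae_right 1 (by norm_num), hs.ae_right 2 (by norm_num)]
    with x h0 h1 h3 c1 c2
  simp only [heightFlux, jetFlux, h0, h1, h3, c1, c2]

lemma IsSlice.ae_concFlux {M g t : ℝ} {p q : ℕ → ℝ → ℝ}
    (hs : IsSlice L M g (h t) (c t) (fun j => H j t) (fun j => C j t) p q) :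
    ∀ᵐ x ∂volume.restrict (Ioo 0 L),
      concFlux H C t x = jetConcFlux (fun j => p j x) (fun j => q j x) := by
  filter_upwards [hs.ae_heightFlux, hs.ae_left 0 (by norm_num), hs.ae_left 1 (by norm_num),
    hs.ae_left 2 (by norm_num), hs.ae_right 0 (by norm_num), hs.ae_right 1 (by norm_num),
    hs.ae_right 2 (by norm_num), hs.ae_right 3 (by norm_num)] with x hJ h0 h1 h2 c0 c1 c2 c3
  simp only [concFlux, jetConcFlux, hJ, chemPotentialDeriv, jetPotential, h0, h1, h2, c0, c1, c2,
    c3]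

/-- A function on the space-time domain whose time slices have an integrable sup bound is
integrable. -/
lemma integrable_of_slice_bound {F : ℝ → ℝ → ℝ} {G : ℝ → ℝ} (hL : 0 < L)
    (hF : AEStronglyMeasurable (Function.uncurry F)
      ((volume.restrict (Ioo 0 T)).prod (volume.restrict (Ioo 0 L))))
    (hG : Integrable G (volume.restrict (Ioo 0 T)))
    (hb : ∀ᵐ t ∂volume.restrict (Ioo 0 T), ∀ᵐ x ∂volume.restrict (Ioo 0 L), |F t x| ≤ G t) :
    Integrable (Function.uncurry F)
      ((volume.restrict (Ioo 0 T)).prod (volume.restrict (Ioo 0 L))) := by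
  rw [integrable_prod_iff hF]
  constructor
  · filter_upwards [hb, hF.prodMk_left] with t ht hm
    exact Integrable.of_bound hm (G t) ht
  · refine (hG.const_mul L).mono' hF.norm.integral_prod_right' ?_
    filter_upwards [hb] with t ht
    have := norm_integral_le_of_norm_le_const (f := fun x => ‖F t x‖) (C := G t)
      (μ := volume.restrict (Ioo 0 L)) (by
        filter_upwards [ht] with x hx
        rwa [norm_norm])
    refine this.trans_eq ?_
    rw [measureReal_restrict_apply_univ, Real.volume_real_Ioo_of_le hL.le, sub_zero, mul_comm]

lemma aestronglyMeasurable_heightFlux (hH : InRegularityClass L T h H)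
    (hC : InRegularityClass L T c C) :
    AEStronglyMeasurable (Function.uncurry (heightFlux H C))
      ((volume.restrict (Ioo 0 T)).prod (volume.restrict (Ioo 0 L))) := by
  have h0 := (hH.aestronglyMeasurable 0 (by norm_num)).aemeasurable
  have h1 := (hH.aestronglyMeasurable 1 (by norm_num)).aemeasurable
  have h3 := (hH.aestronglyMeasurable 3 (by norm_num)).aemeasurable
  have c1 := (hC.aestronglyMeasurable 1 (by norm_num)).aemeasurable
  have c2 := (hC.aestronglyMeasurable 2 (by norm_num)).aemeasurable
  exact ((((h0.pow_const 3).mul h3).sub (h1.div h0)).sub ((h0.pow_const 2).mul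
    ((h1.mul (c1.pow_const 2)).add (((h0.const_mul 2).mul c1).mul c2)))).aestronglyMeasurable

lemma aestronglyMeasurable_concFlux (hH : InRegularityClass L T h H)
    (hC : InRegularityClass L T c C) :
    AEStronglyMeasurable (Function.uncurry (concFlux H C))
      ((volume.restrict (Ioo 0 T)).prod (volume.restrict (Ioo 0 L))) := by
  have hJ := (aestronglyMeasurable_heightFlux hH hC).aemeasurable
  have h0 := (hH.aestronglyMeasurable 0 (by norm_num)).aemeasurable
  have h1 := (hH.aestronglyMeasurable 1 (by norm_num)).aemeasurable
  have h2 := (hH.aestronglyMeasurable 2 (by norm_num)).aemeasurable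
  have c0 := (hC.aestronglyMeasurable 0 (by norm_num)).aemeasurable
  have c1 := (hC.aestronglyMeasurable 1 (by norm_num)).aemeasurable
  have c2 := (hC.aestronglyMeasurable 2 (by norm_num)).aemeasurable
  have c3 := (hC.aestronglyMeasurable 3 (by norm_num)).aemeasurable
  exact ((c0.mul hJ).sub (h0.mul ((((((((c0.pow_const 2).const_mul 3).sub_const 1).mul c1).add
    (((h1.pow_const 2).mul c1).div (h0.pow_const 2))).sub ((h2.mul c1).div h0)).sub
      ((h1.mul c2).div h0)).sub c3))).aestronglyMeasurable

/-- Both fluxes grow linearly in g, and g ≤ g² because g ≥ 1, so the integrable function g²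
dominates them up to a constant. -/
lemma integrable_fluxes (hL : 0 < L) (hH : InRegularityClass L T h H)
    (hC : InRegularityClass L T c C) (hpos : ∀ t ∈ Icc 0 T, ∀ x, 0 < h t x) :
    Integrable (Function.uncurry (heightFlux H C))
      ((volume.restrict (Ioo 0 T)).prod (volume.restrict (Ioo 0 L))) ∧
    Integrable (Function.uncurry (concFlux H C))
      ((volume.restrict (Ioo 0 T)).prod (volume.restrict (Ioo 0 L))) := by
  obtain ⟨M, hM, hs⟩ := exists_isSlice hL hH hC hpos
  have hG := integrable_sliceSq hH hC
  have g1 : ∀ t, 1 ≤ √(sliceSq L H C t) := fun t => Real.one_le_sqrt.2 (one_le_sliceSq hL H C t)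
  have g2 : ∀ t, √(sliceSq L H C t) ≤ sliceSq L H C t := fun t => by
    have h1 := one_le_sliceSq hL H C t
    rw [Real.sqrt_le_left (by linarith)]
    nlinarith
  have M0 : 0 ≤ M := by linarith
  constructor
  · refine integrable_of_slice_bound hL (aestronglyMeasurable_heightFlux hH hC)
      (hG.const_mul (5 * M ^ 5)) ?_
    filter_upwards [hs] with t ⟨p, q, hpq⟩
    filter_upwards [hpq.ae_heightFlux, ae_restrict_mem measurableSet_Ioo] with x hx hx'
    rw [hx]
    refine (abs_jetFlux_le hM (g1 t) (hpq.bound x (Ioo_subset_Icc_self hx'))).trans ?_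
    gcongr
    exact g2 t
  · refine integrable_of_slice_bound hL (aestronglyMeasurable_concFlux hH hC)
      (hG.const_mul (13 * M ^ 6)) ?_
    filter_upwards [hs] with t ⟨p, q, hpq⟩
    filter_upwards [hpq.ae_concFlux, ae_restrict_mem measurableSet_Ioo] with x hx hx'
    rw [hx]
    have hb := hpq.bound x (Ioo_subset_Icc_self hx')
    refine (abs_sub_le_add (abs_mul_le_mul hb.c0 (abs_jetFlux_le hM (g1 t) hb))
      (abs_mul_le_mul hb.h0 (abs_jetPotential_le hM (g1 t) hb))).trans ?_
    calc _ = 13 * M ^ 6 * √(sliceSq L H C t) := by ring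
      _ ≤ _ := by gcongr; exact g2 t

end

/-! ### The energy argument and uniqueness -/

section

variable {L T : ℝ} {h c h' c' : ℝ → ℝ → ℝ} {H C H' C' : ℕ → ℝ → ℝ → ℝ}

/-- The concentration difference is recovered from the energy variables by γ = (ω - c' η) / h, with
1/h and c' bounded by M. -/
lemma sq_add_sq_le_energy {M p a b q : ℝ} (hM : 1 ≤ M) (hp : 0 < p) (hpi : p⁻¹ ≤ M)
    (hb : |b| ≤ M) :
    (p - a) ^ 2 + (q - b) ^ 2 ≤
      (1 + 4 * M ^ 4) * (3 * M ^ 15 * (p - a) ^ 2 + (q * p - b * a) ^ 2) := by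
  have M0 : 0 < M := by linarith
  have e : q - b = p⁻¹ * (q * p - b * a) - p⁻¹ * b * (p - a) := by
    field_simp
    ring
  have i1 : |p⁻¹| ≤ M := by rwa [abs_of_pos (inv_pos.2 hp)]
  have i2 : |p⁻¹ * b| ≤ M * M := abs_mul_le_mul i1 hb
  have j1 : (p⁻¹) ^ 2 ≤ M ^ 2 := sq_le_sq' (abs_le.1 i1).1 (abs_le.1 i1).2
  have j2 : (p⁻¹ * b) ^ 2 ≤ (M * M) ^ 2 := sq_le_sq' (abs_le.1 i2).1 (abs_le.1 i2).2
  have k1 : (q - b) ^ 2 ≤ 2 * ((p⁻¹) ^ 2 * (q * p - b * a) ^ 2) +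
      2 * ((p⁻¹ * b) ^ 2 * (p - a) ^ 2) := by
    rw [e]
    linear_combination sq_nonneg (p⁻¹ * (q * p - b * a) + p⁻¹ * b * (p - a))
  set x := (p - a) ^ 2 with hx
  set y := (q * p - b * a) ^ 2 with hy
  have x0 : 0 ≤ x := sq_nonneg _
  have y0 : 0 ≤ y := sq_nonneg _
  have l1 := mul_le_mul_of_nonneg_right j1 y0
  have l2 := mul_le_mul_of_nonneg_right j2 x0
  have M2 : M ^ 2 ≤ M ^ 4 := pow_le_pow_right₀ hM (by norm_num)
  have M15 : 1 ≤ M ^ 15 := one_le_pow₀ hM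
  have n1 := mul_le_mul_of_nonneg_right M2 y0
  have n2 : (1 + 4 * M ^ 4) * (1 * x) ≤ (1 + 4 * M ^ 4) * (M ^ 15 * x) := by gcongr
  have n3 : 0 ≤ M ^ 4 * y := by positivity
  have n4 : 0 ≤ M ^ 4 * x := by positivity
  have n5 : (M * M) ^ 2 * x = M ^ 4 * x := by ring
  linarith

/-- The energy identity for the difference of two solutions of conservation laws. -/
lemma energy_identity_sub {u v F G : ℝ → ℝ → ℝ} (hL : 0 < L) (hT : 0 < T)
    (hu : IsC1Periodic L T u) (hv : IsC1Periodic L T v)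
    (hF : Integrable (Function.uncurry F)
      ((volume.restrict (Ioo 0 T)).prod (volume.restrict (Ioo 0 L))))
    (hG : Integrable (Function.uncurry G)
      ((volume.restrict (Ioo 0 T)).prod (volume.restrict (Ioo 0 L))))
    (lu : WeakConservationLaw L T u F) (lv : WeakConservationLaw L T v G) {t : ℝ}
    (ht : t ∈ Icc 0 T) :
    (∫ x in (0 : ℝ)..L, (u t x - v t x) ^ 2) - (∫ x in (0 : ℝ)..L, (u 0 x - v 0 x) ^ 2) =
      2 * ∫ s in (0 : ℝ)..t, ∫ x in (0 : ℝ)..L,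
        deriv (fun x => u s x - v s x) x * (F s x - G s x) := by
  refine energy_identity (F := fun s x => F s x - G s x) hL hT (hu.sub hv) (hF.sub hG) ?_ ht
  intro ψ hψ hper t ht
  have hψ' := hψ.continuous_deriv le_rfl
  have a1 := lu.integral_sub_eq hL hT hu.continuousOn hF hψ hper ht
  have a2 := lv.integral_sub_eq hL hT hv.continuousOn hG hψ hper ht
  have h0 : (0 : ℝ) ∈ Icc 0 T := ⟨le_rfl, hT.le⟩
  have split : ∀ s ∈ Icc 0 T, ∫ x in (0 : ℝ)..L, ψ x * (u s x - v s x) =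
      (∫ x in (0 : ℝ)..L, ψ x * u s x) - ∫ x in (0 : ℝ)..L, ψ x * v s x := by
    intro s hs
    simp only [mul_sub]
    exact intervalIntegral.integral_sub
      ((hψ.continuous.mul (continuous_slice hu.continuousOn hs)).intervalIntegrable _ _)
      ((hψ.continuous.mul (continuous_slice hv.continuousOn hs)).intervalIntegrable _ _)
  have iF := integrable_continuousOn_mul (L := L) (T := T) (g := fun _ => deriv ψ)
    (hψ'.comp continuous_snd).continuousOn hF
  have iG := integrable_continuousOn_mul (L := L) (T := T) (g := fun _ => deriv ψ)
    (hψ'.comp continuous_snd).continuousOn hG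
  have sub : uIcc 0 t ⊆ uIcc 0 T := by
    rw [uIcc_of_le hT.le, uIcc_of_le ht.1]; exact Icc_subset_Icc_right ht.2
  have e : ∫ s in (0 : ℝ)..t, ∫ x in (0 : ℝ)..L, deriv ψ x * (F s x - G s x) =
      ∫ s in (0 : ℝ)..t, ((∫ x in (0 : ℝ)..L, deriv ψ x * F s x) -
        ∫ x in (0 : ℝ)..L, deriv ψ x * G s x) := by
    rw [intervalIntegral_eq_Ioo ht.1, intervalIntegral_eq_Ioo ht.1]
    refine integral_congr_ae (ae_mono (Measure.restrict_mono (Ioo_subset_Ioo_right ht.2) le_rfl)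
      ?_)
    filter_upwards [ae_intervalIntegrable_slice hL.le iF,
      ae_intervalIntegrable_slice hL.le iG] with s h1 h2
    simp only [mul_sub]
    exact intervalIntegral.integral_sub h1 h2
  rw [split t ht, split 0 h0, e, intervalIntegral.integral_sub
    ((intervalIntegrable_integral_slice hL.le hT.le iF).mono_set sub)
    ((intervalIntegrable_integral_slice hL.le hT.le iG).mono_set sub), ← a1, ← a2]
  ring

/-- Two solutions with the same initial data coincide. -/
lemma eq_of_weakConservationLaw (hL : 0 < L) (hT : 0 < T)
    (hH : InRegularityClass L T h H) (hC : InRegularityClass L T c C)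
    (hH' : InRegularityClass L T h' H') (hC' : InRegularityClass L T c' C')
    (hpos : ∀ t ∈ Icc 0 T, ∀ x, 0 < h t x) (hpos' : ∀ t ∈ Icc 0 T, ∀ x, 0 < h' t x)
    (e1 : WeakConservationLaw L T h (heightFlux H C))
    (e2 : WeakConservationLaw L T (fun t x => c t x * h t x) (concFlux H C))
    (e1' : WeakConservationLaw L T h' (heightFlux H' C'))
    (e2' : WeakConservationLaw L T (fun t x => c' t x * h' t x) (concFlux H' C'))
    (i1 : ∀ x, h 0 x = h' 0 x) (i2 : ∀ x, c 0 x = c' 0 x) :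
    ∀ t ∈ Icc 0 T, ∀ x, h t x = h' t x ∧ c t x = c' t x := by
  have rh := hH.isC1Periodic
  have rc := hC.isC1Periodic
  have rh' := hH'.isC1Periodic
  have rc' := hC'.isC1Periodic
  obtain ⟨FJ, FK⟩ := integrable_fluxes hL hH hC hpos
  obtain ⟨FJ', FK'⟩ := integrable_fluxes hL hH' hC' hpos'
  have E1 := fun t (ht : t ∈ Icc 0 T) => energy_identity_sub hL hT rh rh' FJ FJ' e1 e1' ht
  have E2 := fun t (ht : t ∈ Icc 0 T) =>
    energy_identity_sub hL hT (rc.mul rh) (rc'.mul rh') FK FK' e2 e2' ht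
  obtain ⟨M1, hM1, s1⟩ := exists_isSlice hL hH hC hpos
  obtain ⟨M2, hM2, s2⟩ := exists_isSlice hL hH' hC' hpos'
  -- One M must serve both solutions, since Λ and K are chosen from it.
  obtain ⟨M, hM, l1, l2⟩ : ∃ M, 1 ≤ M ∧ M1 ≤ M ∧ M2 ≤ M :=
    ⟨max M1 M2, hM1.trans (le_max_left _ _), le_max_left _ _, le_max_right _ _⟩
  obtain ⟨K, hK, hpow⟩ := integral_powerDensity_le hL hM
  have M0 : 0 < M := by linarith
  set Λ : ℝ := 3 * M ^ 15 with hΛ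
  have Λ0 : 0 < Λ := by positivity
  set S : ℝ → ℝ := fun t => sliceSq L H C t + sliceSq L H' C' t with hS
  have S0 : ∀ t, 1 ≤ S t := fun t => by
    have := one_le_sliceSq hL H C t
    have := one_le_sliceSq hL H' C' t
    simp only [hS]; linarith
  have SI : IntervalIntegrable S volume 0 T :=
    (intervalIntegrable_iff_Ioo hT.le).2
      ((integrable_sliceSq hH hC).add (integrable_sliceSq hH' hC'))
  set η : ℝ → ℝ → ℝ := fun t x => h t x - h' t x with hη
  set ω : ℝ → ℝ → ℝ := fun t x => c t x * h t x - c' t x * h' t x with hω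
  have rη : IsC1Periodic L T η := rh.sub rh'
  have rω : IsC1Periodic L T ω := (rc.mul rh).sub (rc'.mul rh')
  set E : ℝ → ℝ := fun t => Λ * (∫ x in (0 : ℝ)..L, η t x ^ 2) +
    ∫ x in (0 : ℝ)..L, ω t x ^ 2 with hE
  have sqc : ∀ {u : ℝ → ℝ → ℝ}, IsC1Periodic L T u →
      ContinuousOn (fun t => ∫ x in (0 : ℝ)..L, u t x ^ 2) (Icc 0 T) := fun {u} hu =>
    continuousOn_integral_slice hT.le (g := fun t x => u t x ^ 2) (hu.continuousOn.pow 2 :)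
  have Ec : ContinuousOn E (Icc 0 T) := (continuousOn_const.mul (sqc rη)).add (sqc rω)
  have nη : ∀ t, 0 ≤ ∫ x in (0 : ℝ)..L, η t x ^ 2 := fun t =>
    intervalIntegral.integral_nonneg hL.le fun x _ => sq_nonneg _
  have nω : ∀ t, 0 ≤ ∫ x in (0 : ℝ)..L, ω t x ^ 2 := fun t =>
    intervalIntegral.integral_nonneg hL.le fun x _ => sq_nonneg _
  have E0 : ∀ t, 0 ≤ E t := fun t => add_nonneg (mul_nonneg Λ0.le (nη t)) (nω t)
  have hp1 := integrable_continuousOn_mul (L := L) (g := fun t => deriv (η t))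
    (F := fun s x => heightFlux H C s x - heightFlux H' C' s x)
    rη.continuousOn_deriv (FJ.sub FJ')
  have hp2 := integrable_continuousOn_mul (L := L) (g := fun t => deriv (ω t))
    (F := fun s x => concFlux H C s x - concFlux H' C' s x)
    rω.continuousOn_deriv (FK.sub FK')
  set P1 : ℝ → ℝ := fun s => ∫ x in (0 : ℝ)..L,
    deriv (η s) x * (heightFlux H C s x - heightFlux H' C' s x) with hP1
  set P2 : ℝ → ℝ := fun s => ∫ x in (0 : ℝ)..L,
    deriv (ω s) x * (concFlux H C s x - concFlux H' C' s x) with hP2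
  have P1i : IntervalIntegrable P1 volume 0 T :=
    intervalIntegrable_integral_slice (F := fun s x =>
      deriv (η s) x * (heightFlux H C s x - heightFlux H' C' s x)) hL.le hT.le hp1
  have P2i : IntervalIntegrable P2 volume 0 T :=
    intervalIntegrable_integral_slice (F := fun s x =>
      deriv (ω s) x * (concFlux H C s x - concFlux H' C' s x)) hL.le hT.le hp2
  -- The differential inequality E' ≤ C g² E at almost every time, with S in the role of g² for both
  -- solutions together.
  have rate : ∀ᵐ s ∂volume.restrict (Ioo 0 T), 2 * (Λ * P1 s + P2 s) ≤
      2 * K * (1 + 4 * M ^ 4) * S s * E s := by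
    filter_upwards [s1, s2, ae_intervalIntegrable_slice hL.le hp1,
      ae_intervalIntegrable_slice hL.le hp2, ae_restrict_mem measurableSet_Ioo]
      with s ⟨p, q, hpq⟩ ⟨a, b, hab⟩ j1 j2 hs
    have hs' := Ioo_subset_Icc_self hs
    have g1 : √(sliceSq L H C s) ≤ √(S s) := by
      refine Real.sqrt_le_sqrt ?_
      have := one_le_sliceSq hL H' C' s
      simp only [hS]; linarith
    have g2 : √(sliceSq L H' C' s) ≤ √(S s) := by
      refine Real.sqrt_le_sqrt ?_
      have := one_le_sliceSq hL H C s
      simp only [hS]; linarith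
    have hb1 : ∀ x ∈ Icc 0 L, JetBound M √(S s) (fun j => p j x) (fun j => q j x) :=
      fun x hx => (hpq.bound x hx).mono l1 g1
    have hb2 : ∀ x ∈ Icc 0 L, JetBound M √(S s) (fun j => a j x) (fun j => b j x) :=
      fun x hx => (hab.bound x hx).mono l2 g2
    have key := hpow √(S s) p q a b (Real.one_le_sqrt.2 (S0 s)) hpq.profile_left
      hpq.profile_right hab.profile_left hab.profile_right hb1 hb2
    rw [Real.sq_sqrt (by linarith [S0 s])] at key
    -- The fluxes use weak derivatives and the test factors classical ones; both agree almost
    -- everywhere with the smooth representatives.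
    have hP : Λ * P1 s + P2 s = ∫ x in (0 : ℝ)..L, powerDensity Λ (fun j => p j x)
        (fun j => q j x) (fun j => a j x) (fun j => b j x) := by
      simp only [hP1, hP2]
      rw [← intervalIntegral.integral_const_mul, ← intervalIntegral.integral_add
        (j1.const_mul Λ) j2, intervalIntegral_eq_Ioo hL.le, intervalIntegral_eq_Ioo hL.le]
      refine integral_congr_ae ?_
      filter_upwards [hpq.ae_heightFlux, hpq.ae_concFlux, hab.ae_heightFlux, hab.ae_concFlux]
        with x f1 f2 f3 f4
      have dh := rh.differentiable s hs' x
      have dc := rc.differentiable s hs' x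
      have dh' := rh'.differentiable s hs' x
      have dc' := rc'.differentiable s hs' x
      have d1 : deriv (η s) x = p 1 x - a 1 x := by
        rw [hpq.left_one, hab.left_one]
        exact deriv_fun_sub dh dh'
      have d2 : deriv (ω s) x = prodDiff (fun j => p j x) (fun j => q j x) (fun j => a j x)
          (fun j => b j x) 1 := by
        simp only [prodDiff, hpq.left_one, hab.left_one, hpq.left_zero, hab.left_zero,
          hpq.right_one, hab.right_one, hpq.right_zero, hab.right_zero]
        simp only [hω]
        rw [deriv_fun_sub (dc.fun_mul dh) (dc'.fun_mul dh'), deriv_fun_mul dc dh,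
          deriv_fun_mul dc' dh']
      rw [f1, f2, f3, f4, d1, d2]
      rfl
    rw [← hP] at key
    have cη : Continuous (η s) := continuous_slice rη.continuousOn hs'
    have cω : Continuous (ω s) := continuous_slice rω.continuousOn hs'
    have cmp : ∫ x in (0 : ℝ)..L, ((p 0 x - a 0 x) ^ 2 + (q 0 x - b 0 x) ^ 2) ≤
        (1 + 4 * M ^ 4) * E s := by
      have eE : (1 + 4 * M ^ 4) * E s =
          ∫ x in (0 : ℝ)..L, (1 + 4 * M ^ 4) * (Λ * η s x ^ 2 + ω s x ^ 2) := by
        rw [intervalIntegral.integral_const_mul, intervalIntegral.integral_add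
          (Continuous.intervalIntegrable (by fun_prop) _ _)
          (Continuous.intervalIntegrable (by fun_prop) _ _), intervalIntegral.integral_const_mul]
      rw [eE]
      have ch := continuous_slice rh.continuousOn hs'
      have cc := continuous_slice rc.continuousOn hs'
      have ch' := continuous_slice rh'.continuousOn hs'
      have cc' := continuous_slice rc'.continuousOn hs'
      rw [hpq.left_zero, hpq.right_zero, hab.left_zero, hab.right_zero]
      refine intervalIntegral.integral_mono_on hL.le
        (Continuous.intervalIntegrable (by fun_prop) _ _)
        (Continuous.intervalIntegrable (by fun_prop) _ _) fun x hx => ?_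
      have B1 := hb1 x hx
      have B2 := hb2 x hx
      have pi := B1.inv
      have bb := B2.c0
      simp only [hpq.left_zero, hab.right_zero] at pi bb
      exact sq_add_sq_le_energy hM (hpos s hs' x) pi bb
    have S1 : 0 ≤ K * S s := mul_nonneg hK.le (by linarith [S0 s])
    have := mul_le_mul_of_nonneg_left cmp S1
    linarith
  have EZ : ∀ t ∈ Icc 0 T, E t = 0 := by
    refine eq_zero_of_le_integral_mul (α := fun s => 2 * K * (1 + 4 * M ^ 4) * S s) hT.le Ec
      (fun t _ => E0 t) (SI.const_mul _) (fun t => ?_) fun t ht => ?_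
    · exact mul_nonneg (by positivity) (by linarith [S0 t])
    · have sub : uIcc 0 t ⊆ uIcc 0 T := by
        rw [uIcc_of_le hT.le, uIcc_of_le ht.1]; exact Icc_subset_Icc_right ht.2
      have eE : E t = ∫ s in (0 : ℝ)..t, 2 * (Λ * P1 s + P2 s) := by
        have a1 := E1 t ht
        have a2 := E2 t ht
        have z1 : ∫ x in (0 : ℝ)..L, (h 0 x - h' 0 x) ^ 2 = 0 := by simp [i1]
        have z2 : ∫ x in (0 : ℝ)..L, (c 0 x * h 0 x - c' 0 x * h' 0 x) ^ 2 = 0 := by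
          simp [i1, i2]
        rw [z1, sub_zero] at a1
        rw [z2, sub_zero] at a2
        rw [intervalIntegral.integral_const_mul, intervalIntegral.integral_add
          ((P1i.mono_set sub).const_mul Λ) (P2i.mono_set sub),
          intervalIntegral.integral_const_mul]
        change Λ * (∫ x in (0 : ℝ)..L, (h t x - h' t x) ^ 2) +
          ∫ x in (0 : ℝ)..L, (c t x * h t x - c' t x * h' t x) ^ 2 = _
        rw [a1, a2]
        ring
      rw [eE]
      have iSE : IntervalIntegrable (fun s => 2 * K * (1 + 4 * M ^ 4) * S s * E s) volume 0 T :=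
        (SI.const_mul _).mul_continuousOn (by rwa [uIcc_of_le hT.le])
      refine intervalIntegral.integral_mono_ae_restrict ht.1
        ((((P1i.const_mul Λ).add P2i).const_mul 2).mono_set sub) (iSE.mono_set sub) ?_
      rw [← restrict_Ioo_eq_restrict_Icc]
      exact ae_mono (Measure.restrict_mono (Ioo_subset_Ioo_right ht.2) le_rfl) rate
  intro t ht
  have hEt := EZ t ht
  have zη : ∫ x in (0 : ℝ)..L, η t x ^ 2 = 0 := by
    have := mul_nonneg Λ0.le (nη t)
    have h0 : Λ * ∫ x in (0 : ℝ)..L, η t x ^ 2 = 0 := by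
      have := nω t
      simp only [hE] at hEt
      linarith
    exact (mul_eq_zero.1 h0).resolve_left Λ0.ne'
  have zω : ∫ x in (0 : ℝ)..L, ω t x ^ 2 = 0 := by
    simp only [hE, zη, mul_zero, zero_add] at hEt
    exact hEt
  have vanish : ∀ {u : ℝ → ℝ → ℝ}, IsC1Periodic L T u → ∫ x in (0 : ℝ)..L, u t x ^ 2 = 0 →
      ∀ x, u t x = 0 := by
    intro u hu h0 x
    -- The vanishing integral controls one period only; periodicity carries the conclusion to every
    -- x.
    obtain ⟨y, hy, e⟩ := (hu.periodic t ht).exists_mem_Ico₀ hL x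
    rw [e]
    exact eq_zero_of_integral_sq hL (continuous_slice hu.continuousOn ht).continuousOn h0 y
      ⟨hy.1, hy.2.le⟩
  intro x
  have hx1 := vanish rη zη x
  have hx2 := vanish rω zω x
  simp only [hη] at hx1
  simp only [hω] at hx2
  have eh : h t x = h' t x := by linarith
  refine ⟨eh, ?_⟩
  rw [← eh, ← sub_mul] at hx2
  have := (mul_eq_zero.1 hx2).resolve_right (hpos t ht x).ne'
  linarith

end

end ThinFilm

theorem mainTheorem3 (L T : ℝ) (hL : 0 < L) (hT : 0 < T) (h₀ c₀ : ℝ → ℝ)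
    (h c h' c' : ℝ → ℝ → ℝ)
    (hsol : ThinFilm.IsSolution L T h₀ c₀ h c)
    (hsol' : ThinFilm.IsSolution L T h₀ c₀ h' c') :
    ∀ t ∈ Set.Icc 0 T, ∀ x : ℝ, h t x = h' t x ∧ c t x = c' t x := by
  obtain ⟨a1, a2, hpos, H, C, hH, hC, e1, e2⟩ := hsol
  obtain ⟨b1, b2, hpos', H', C', hH', hC', e1', e2'⟩ := hsol'
  exact ThinFilm.eq_of_weakConservationLaw hL hT hH hC hH' hC' hpos hpos' e1 e2 e1' e2'
    (fun x => (a1 x).trans (b1 x).symm) (fun x => (a2 x).trans (b2 x).symm)
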